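/- Identify $\mathbb S$ with $\mathbb R/\mathbb Z$. For a smooth closed immersed curve $\gamma:\mathbb S\to\mathbb R^2$ with arclength $s$, unit tangent $\tau=\gamma_s=(\tau_1,\tau_2)$, unit normal $\nu=(-\tau_2,\tau_1)$ and curvature $k=\langle\gamma_{ss},\nu\rangle$, let $$L[\gamma]=\int_\gamma ds,\qquad E[\gamma]=\tfrac12\int_\gamma k_s^2\,ds,\qquad \omega[\gamma]=\tfrac1{2\pi}\int_\gamma k\,ds\in\mathbb Z,\qquad \mathcal K[\gamma]=k_{ssss}+k_{ss}k^2-\tfrac12k_s^2k,$$ let $\|\mathcal K\|_2^2=\int_\gamma\mathcal K^2\,ds$, and write $(L^3E)[\gamma]=L[\gamma]^3E[\gamma]$. An ideal curve flow with initial curve $\gamma_0$ is a smooth map $\gamma:\mathbb S\times[0,\infty)\to\mathbb R^2$ such that each $\gamma_t=\gamma(\cdot,t)$ is an immersed curve, $\gamma(\cdot,0)=\gamma_0$, and $\partial_t\gamma=\mathcal K\,\nu$. **Proposition.** For every integer $\omega$ and every $\varepsilon_0>0$ there are constants $\varepsilon_1,\varepsilon_2,C_0$ with $0<\varepsilon_2\le\varepsilon_1<\varepsilon_0$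 and $C_0>0$, depending only on $\omega$ and $\varepsilon_0$, such that the following holds for every smooth closed immersed curve $\gamma_0:\mathbb S\to\mathbb R^2$ with $\omega[\gamma_0]=\omega$ and every ideal curve flow $\gamma:\mathbb S\times[0,\infty)\to\mathbb R^2$ with initial curve $\gamma_0$. 1. If $(L^3E)[\gamma_0]<\varepsilon_1$, then $t\mapsto(L^3E)[\gamma_t]$ is non-increasing on $[0,\infty)$; in particular $(L^3E)[\gamma_t]\le(L^3E)[\gamma_0]$ for all $t\ge0$. 2. If $(L^3E)[\gamma_0]<\varepsilon_2$, then for every $t\in[0,\infty)$ the function $r\mapsto L[\gamma_r]^3\,\|\mathcal K[\gamma_r]\|_2^2$ is integrable on $[0,t]$ and $$\int_0^t L[\gamma_r]^3\,\|\mathcal K[\gamma_r]\|_2^2\,dr\le C_0\Big[(L^3E)[\gamma_0]-(L^3E)[\gamma_t]\Big].$$ -/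

import Mathlib

noncomputable section

namespace IdealCurve

/-! Planar curves. The Euclidean plane `ℝ²` is modelled by `ℂ` with its real inner product
(the dot product); multiplication by `Complex.I` is the rotation `(x, y) ↦ (-y, x)`.
Maps from the circle `ℝ / ℤ` are given as functions on `ℝ` of period `1`. -/

/-- A smooth closed immersed planar curve, i.e. a smooth immersion of the circle. -/
structure IsSmoothImmersedClosedCurve (γ : ℝ → ℂ) : Prop where
  smooth : ContDiff ℝ ((⊤ : ℕ∞) : WithTop ℕ∞) γ
  periodic : Function.Periodic γ 1
  immersed : ∀ u, deriv γ u ≠ 0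

/-- The speed `|∂ᵤγ|`, so that `ds = speed γ du`. -/
def speed (γ : ℝ → ℂ) (u : ℝ) : ℝ := ‖deriv γ u‖

/-- The arclength derivative `∂ₛ f = |∂ᵤγ|⁻¹ ∂ᵤ f` of a function along the curve `γ`. -/
def arcDeriv {F : Type} [NormedAddCommGroup F] [NormedSpace ℝ F]
    (γ : ℝ → ℂ) (f : ℝ → F) (u : ℝ) : F :=
  (speed γ u)⁻¹ • deriv f u

/-- The integral `∫_γ f ds` over one period. -/
def arcIntegral (γ : ℝ → ℂ) (f : ℝ → ℝ) : ℝ :=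
  ∫ u in (0 : ℝ)..1, f u * speed γ u

/-- The unit tangent `τ = γₛ`. -/
def tangent (γ : ℝ → ℂ) : ℝ → ℂ := arcDeriv γ γ

/-- The unit normal `ν = (-τ₂, τ₁)`. -/
def normal (γ : ℝ → ℂ) (u : ℝ) : ℂ := Complex.I * tangent γ u

/-- The curvature `k = ⟨γₛₛ, ν⟩`. -/
def curvature (γ : ℝ → ℂ) (u : ℝ) : ℝ :=
  inner ℝ (arcDeriv γ (tangent γ) u) (normal γ u)

/-- The `n`-th arclength derivative of the curvature. -/
def curvatureDeriv (γ : ℝ → ℂ) (n : ℕ) : ℝ → ℝ := (arcDeriv γ)^[n] (curvature γ)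

/-- The length `L[γ]`. -/
def length (γ : ℝ → ℂ) : ℝ := arcIntegral γ (fun _ => 1)

/-- The energy `E[γ] = ½ ∫_γ kₛ² ds`. -/
def energy (γ : ℝ → ℂ) : ℝ :=
  1 / 2 * arcIntegral γ (fun u => curvatureDeriv γ 1 u ^ 2)

/-- The scale-invariant energy `(L³E)[γ]`. -/
def scaledEnergy (γ : ℝ → ℂ) : ℝ := length γ ^ 3 * energy γ

/-- The winding (turning) number `(1 / 2π) ∫_γ k ds`. -/
def windingNumber (γ : ℝ → ℂ) : ℝ :=
  1 / (2 * Real.pi) * arcIntegral γ (curvature γ)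

/-- The Euler-Lagrange operator `𝒦[γ] = k_{ssss} + k_{ss} k² - ½ kₛ² k`. -/
def idealOp (γ : ℝ → ℂ) (u : ℝ) : ℝ :=
  curvatureDeriv γ 4 u + curvatureDeriv γ 2 u * curvature γ u ^ 2
    - 1 / 2 * curvatureDeriv γ 1 u ^ 2 * curvature γ u

/-- The squared norm `‖𝒦‖₂² = ∫_γ 𝒦² ds`. -/
def idealOpNormSq (γ : ℝ → ℂ) : ℝ := arcIntegral γ (fun u => idealOp γ u ^ 2)

/-- `γ t u`, for `t ∈ [0, ∞)`, is an ideal curve flow with initial curve `γ₀`: a family of closed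
immersed curves, jointly smooth in `(t, u)` on `[0, ∞) × ℝ` (up to the initial time), that solves
`∂ₜγ = 𝒦 ν` (with the one-sided time derivative at `t = 0`). -/
structure IsIdealCurveFlow (γ₀ : ℝ → ℂ) (γ : ℝ → ℝ → ℂ) : Prop where
  initial : γ 0 = γ₀
  smooth : ContDiffOn ℝ ((⊤ : ℕ∞) : WithTop ℕ∞) (fun p : ℝ × ℝ => γ p.1 p.2) (Set.Ici 0 ×ˢ Set.univ)
  curve : ∀ t, 0 ≤ t → IsSmoothImmersedClosedCurve (γ t)
  evolution : ∀ t, 0 ≤ t → ∀ u,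
    HasDerivWithinAt (fun r => γ r u) (idealOp (γ t) u • normal (γ t) u) (Set.Ici 0) t

end IdealCurve

end

noncomputable section

namespace IdealCurve

open intervalIntegral

/-! ### Integrals against a positive weight on the unit interval -/

section Weighted

variable {F : Type} [NormedAddCommGroup F] [NormedSpace ℝ F] {v : ℝ → ℝ}

/-! Along the flow `E' = -‖𝒦‖²`, `L' = -∫ k 𝒦` and the winding number is constant, so `(L³E)' = 3L²E
· (-∫ k 𝒦) - L³‖𝒦‖²`. Everything rests on a static estimate: for small `L³E` the first term is at
most half of `L³‖𝒦‖²`. Then `(L³E)' ≤ -½ L³‖𝒦‖²` as long as `L³E` is below the threshold; a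
first-exit-time argument (`antitoneOn_of_deriv_nonpos_of_lt`) shows that it stays below, and
integration gives part 2 with constant 2.

Integration by parts gives `∫ k 𝒦 = ∫ k_ss² - 7/2 ∫ k² k_s²`, so only `∫ k² k_s²` has to be bounded.
The curvature is `O(1/L)`, its mean being fixed by the winding number, and `|k_s| ≤ L P` with `P =
max |k_ss|`. Hence it suffices that `P ≤ 2L ∫ |𝒦|`, which is `IsFrenet.abs_second_deriv_le`.

That bound uses a factorisation of the leading part of `𝒦` through the rotating frame. With `τ_s = i
k τ`, one has `∂ₛ(τ̄ k_ss) = τ̄ (k_sss - i k k_ss)` and `∂ₛ(τ (k_sss - i k k_ss)) = τ (𝒦 + ½ k_s² k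
- i k_s k_ss)`. Applying twice the fact that a function differs from its mean by at most its total
variation recovers `k_ss` from `𝒦`, up to the quadratic terms and the two means. By parts the means
become moments of `τ` against `k³`, `k⁴` and `k_s²`. Since the curve and its tangent close up, `∫ τ
= ∫ k τ = 0`, so affine functions of `k` have no moment and the moments of `k³`, `k⁴` are quadratic
in the deviation of `k` from its mean. All errors are therefore `O(δ P)` with `δ = L ∫ |k_s| ≤ (2
L³E)^{1/2}`, and are absorbed into `P`. -/

lemma integral_weighted_mono (hv : Continuous v) (hv0 : ∀ u, 0 < v u) {f g : ℝ → ℝ}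
    (hf : Continuous f) (hg : Continuous g) (h : ∀ u ∈ Set.Icc (0 : ℝ) 1, f u ≤ g u) :
    ∫ u in (0 : ℝ)..1, v u * f u ≤ ∫ u in (0 : ℝ)..1, v u * g u := by
  apply integral_mono_on zero_le_one
  · exact (hv.mul hf).intervalIntegrable _ _
  · exact (hv.mul hg).intervalIntegrable _ _
  · intro u hu
    exact mul_le_mul_of_nonneg_left (h u hu) (hv0 u).le

lemma integral_weighted_le (hv : Continuous v) (hv0 : ∀ u, 0 < v u) {f : ℝ → ℝ}
    (hf : Continuous f) {C : ℝ} (h : ∀ u ∈ Set.Icc (0 : ℝ) 1, f u ≤ C) :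
    ∫ u in (0 : ℝ)..1, v u * f u ≤ (∫ u in (0 : ℝ)..1, v u) * C := by
  have := integral_weighted_mono hv hv0 hf continuous_const h
  rwa [integral_mul_const] at this

lemma norm_integral_weighted_le (hv0 : ∀ u, 0 < v u) (f : ℝ → F) :
    ‖∫ u in (0 : ℝ)..1, v u • f u‖ ≤ ∫ u in (0 : ℝ)..1, v u * ‖f u‖ := by
  refine (norm_integral_le_integral_norm zero_le_one).trans_eq ?_
  congr 1 with u
  rw [norm_smul, Real.norm_of_nonneg (hv0 u).le]

lemma integral_weighted_pos (hv : Continuous v) (hv0 : ∀ u, 0 < v u) :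
    0 < ∫ u in (0 : ℝ)..1, v u :=
  intervalIntegral_pos_of_pos (hv.intervalIntegrable _ _) hv0 zero_lt_one

/-- The Cauchy–Schwarz inequality against the constant function `1`. -/
lemma sq_integral_weighted_le (hv : Continuous v) (hv0 : ∀ u, 0 < v u) {f : ℝ → ℝ}
    (hf : Continuous f) :
    (∫ u in (0 : ℝ)..1, v u * f u) ^ 2 ≤
      (∫ u in (0 : ℝ)..1, v u) * ∫ u in (0 : ℝ)..1, v u * f u ^ 2 := by
  set L := ∫ u in (0 : ℝ)..1, v u with hL
  set a := ∫ u in (0 : ℝ)..1, v u * f u with ha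
  have hL0 : 0 < L := integral_weighted_pos hv hv0
  -- Nonnegativity of the variance, with the mean `a / L` cleared of its denominator.
  have h0 : 0 ≤ ∫ u in (0 : ℝ)..1, v u * (L * f u - a) ^ 2 :=
    integral_nonneg zero_le_one fun u _ => mul_nonneg (hv0 u).le (sq_nonneg _)
  have h1 : ∫ u in (0 : ℝ)..1, v u * (L * f u - a) ^ 2 =
      L ^ 2 * (∫ u in (0 : ℝ)..1, v u * f u ^ 2) - 2 * L * a * a + a ^ 2 * L := by
    have e : ∀ u, v u * (L * f u - a) ^ 2 =
        L ^ 2 * (v u * f u ^ 2) - 2 * L * a * (v u * f u) + a ^ 2 * v u := fun u => by ring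
    simp_rw [e]
    rw [intervalIntegral.integral_add, intervalIntegral.integral_sub,
      intervalIntegral.integral_const_mul, intervalIntegral.integral_const_mul,
      intervalIntegral.integral_const_mul]
    all_goals exact Continuous.intervalIntegrable (by fun_prop) _ _
  rw [h1] at h0
  have : 0 ≤ L * (L * (∫ u in (0 : ℝ)..1, v u * f u ^ 2) - a ^ 2) := by nlinarith
  have := nonneg_of_mul_nonneg_right this hL0
  linarith

variable [CompleteSpace F]

lemma integral_weighted_deriv_eq_zero (hv : Continuous v) {f f' : ℝ → F}
    (hf : ∀ u, HasDerivAt f (v u • f' u) u) (hf' : Continuous f') (hp : f 1 = f 0) :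
    ∫ u in (0 : ℝ)..1, v u • f' u = 0 := by
  rw [integral_eq_sub_of_hasDerivAt (fun u _ => hf u)
    ((hv.smul hf').intervalIntegrable _ _), hp, sub_self]

lemma norm_sub_le_integral_weighted (hv : Continuous v) (hv0 : ∀ u, 0 < v u) {f f' : ℝ → F}
    (hf : ∀ u, HasDerivAt f (v u • f' u) u) (hf' : Continuous f')
    {a b : ℝ} (ha : a ∈ Set.Icc (0 : ℝ) 1) (hb : b ∈ Set.Icc (0 : ℝ) 1) :
    ‖f b - f a‖ ≤ ∫ u in (0 : ℝ)..1, v u * ‖f' u‖ := by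
  wlog hab : a ≤ b generalizing a b
  · rw [norm_sub_rev]; exact this hb ha (le_of_not_ge hab)
  rw [← integral_eq_sub_of_hasDerivAt (fun u _ => hf u)
    ((hv.smul hf').intervalIntegrable _ _)]
  refine (norm_integral_le_integral_norm hab).trans ?_
  have e : ∀ u, ‖v u • f' u‖ = v u * ‖f' u‖ := fun u => by
    rw [norm_smul, Real.norm_of_nonneg (hv0 u).le]
  simp_rw [e]
  refine integral_mono_interval ha.1 hab hb.2 ?_ ((hv.mul hf'.norm).intervalIntegrable _ _)
  exact Filter.Eventually.of_forall fun u => mul_nonneg (hv0 u).le (norm_nonneg _)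

/-- A function deviates from its mean by at most the total variation. -/
lemma norm_smul_sub_integral_weighted_le (hv : Continuous v) (hv0 : ∀ u, 0 < v u) {f f' : ℝ → F}
    (hf : ∀ u, HasDerivAt f (v u • f' u) u) (hf' : Continuous f')
    {a : ℝ} (ha : a ∈ Set.Icc (0 : ℝ) 1) :
    ‖(∫ u in (0 : ℝ)..1, v u) • f a - ∫ u in (0 : ℝ)..1, v u • f u‖ ≤
      (∫ u in (0 : ℝ)..1, v u) * ∫ u in (0 : ℝ)..1, v u * ‖f' u‖ := by
  have hfc : Continuous f := continuous_iff_continuousAt.2 fun u => (hf u).continuousAt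
  have e : (∫ u in (0 : ℝ)..1, v u) • f a - ∫ u in (0 : ℝ)..1, v u • f u =
      ∫ u in (0 : ℝ)..1, v u • (f a - f u) := by
    simp_rw [smul_sub]
    rw [intervalIntegral.integral_sub, intervalIntegral.integral_smul_const]
    all_goals exact Continuous.intervalIntegrable (by fun_prop) _ _
  rw [e]
  refine (norm_integral_weighted_le hv0 _).trans ?_
  refine integral_weighted_le hv hv0 (by fun_prop) fun u hu => ?_
  exact norm_sub_le_integral_weighted hv hv0 hf hf' hu ha

end Weighted

/-! ### The static estimate -/

/-- The Frenet equations of a closed planar curve `γ` with speed `v`, unit tangent `τ` and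
curvature `k 0`, where `k n` is the `n`-th arclength derivative of the curvature. -/
structure IsFrenet (v : ℝ → ℝ) (γ τ : ℝ → ℂ) (k : ℕ → ℝ → ℝ) : Prop where
  continuous_speed : Continuous v
  speed_pos : ∀ u, 0 < v u
  curve_deriv : ∀ u, HasDerivAt γ (v u • τ u) u
  tangent_deriv : ∀ u, HasDerivAt τ (v u • (Complex.I * k 0 u * τ u)) u
  curvature_deriv : ∀ n u, HasDerivAt (k n) (v u * k (n + 1) u) u
  norm_tangent : ∀ u, ‖τ u‖ = 1
  curve_closed : γ 1 = γ 0
  tangent_closed : τ 1 = τ 0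
  curvature_closed : ∀ n, k n 1 = k n 0

/-- The Euler–Lagrange operator in terms of the curvature and its derivatives. -/
def frenetOp (k : ℕ → ℝ → ℝ) (u : ℝ) : ℝ :=
  k 4 u + k 2 u * k 0 u ^ 2 - 1 / 2 * k 1 u ^ 2 * k 0 u

/-- For real `f` the two integrals are complex conjugates. This lets the mean of `τ̄ k_ss` be
estimated through moments of `τ`. -/
lemma norm_integral_conj_mul (v f : ℝ → ℝ) (τ : ℝ → ℂ) :
    ‖∫ u in (0 : ℝ)..1, v u • ((starRingEnd ℂ) (τ u) * f u)‖ =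
      ‖∫ u in (0 : ℝ)..1, v u • (f u * τ u)‖ := by
  have e : ∀ u, v u • ((starRingEnd ℂ) (τ u) * f u) =
      (starRingEnd ℂ) (v u • (f u * τ u)) := fun u => by
    simp [mul_comm]
  simp_rw [e]
  rw [integral_of_le zero_le_one, integral_of_le zero_le_one, integral_conj, Complex.norm_conj]

namespace IsFrenet

variable {v : ℝ → ℝ} {γ τ : ℝ → ℂ} {k : ℕ → ℝ → ℝ}

lemma continuous_tangent (h : IsFrenet v γ τ k) : Continuous τ :=
  continuous_iff_continuousAt.2 fun u => (h.tangent_deriv u).continuousAt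

lemma continuous_curvature (h : IsFrenet v γ τ k) (n : ℕ) : Continuous (k n) :=
  continuous_iff_continuousAt.2 fun u => (h.curvature_deriv n u).continuousAt

lemma integral_curvature_deriv (h : IsFrenet v γ τ k) (n : ℕ) :
    ∫ u in (0 : ℝ)..1, v u * k (n + 1) u = 0 :=
  integral_weighted_deriv_eq_zero h.continuous_speed (h.curvature_deriv n)
    (h.continuous_curvature _) (h.curvature_closed n)

lemma integral_tangent (h : IsFrenet v γ τ k) : ∫ u in (0 : ℝ)..1, v u • τ u = 0 :=
  integral_weighted_deriv_eq_zero h.continuous_speed h.curve_deriv h.continuous_tangent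
    h.curve_closed

/-- Here `k τ = -i τ_s` is an exact derivative and the tangent closes up. -/
lemma integral_curvature_mul_tangent (h : IsFrenet v γ τ k) :
    ∫ u in (0 : ℝ)..1, v u • (k 0 u * τ u) = 0 := by
  have := h.continuous_tangent
  have := h.continuous_curvature 0
  have h0 := integral_weighted_deriv_eq_zero h.continuous_speed h.tangent_deriv (by fun_prop)
    h.tangent_closed
  have e : ∀ u, v u • (Complex.I * k 0 u * τ u) = Complex.I * (v u • (k 0 u * τ u)) := fun u => by
    simp only [Complex.real_smul]; ring
  simp_rw [e] at h0
  rw [intervalIntegral.integral_const_mul] at h0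
  simpa using h0

/-- A moment of the tangent against a polynomial in the curvature that is the sum of an affine
function and a multiple of `(k - c) ^ 2` is quadratically small. -/
lemma norm_moment_le (h : IsFrenet v γ τ k) (p q : ℝ → ℝ) (hq : Continuous q)
    (a b c : ℝ) (hpq : ∀ x, p x = a * x + b + (x - c) ^ 2 * q x) {C D : ℝ}
    (hC : ∀ u ∈ Set.Icc (0 : ℝ) 1, (k 0 u - c) ^ 2 ≤ C)
    (hD : ∀ u ∈ Set.Icc (0 : ℝ) 1, |q (k 0 u)| ≤ D) :
    ‖∫ u in (0 : ℝ)..1, v u • (p (k 0 u) * τ u)‖ ≤ (∫ u in (0 : ℝ)..1, v u) * (C * D) := by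
  have hτ := h.continuous_tangent
  have hk := h.continuous_curvature 0
  have hv := h.continuous_speed
  have e : ∀ u, v u • ((p (k 0 u) : ℂ) * τ u) = a * (v u • (k 0 u * τ u)) + b * (v u • τ u) +
      v u • ((((k 0 u - c) ^ 2 * q (k 0 u) : ℝ) : ℂ) * τ u) := fun u => by
    rw [hpq]; simp only [Complex.real_smul]; push_cast; ring
  simp_rw [e]
  -- The affine part of `p` drops out by the two closing conditions; only the quadratic remainder is
  -- left.
  rw [intervalIntegral.integral_add, intervalIntegral.integral_add,
    intervalIntegral.integral_const_mul, intervalIntegral.integral_const_mul,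
    h.integral_tangent, h.integral_curvature_mul_tangent, mul_zero, mul_zero, zero_add, zero_add]
  · refine (norm_integral_weighted_le h.speed_pos _).trans ?_
    refine integral_weighted_le hv h.speed_pos (by fun_prop) fun u hu => ?_
    rw [norm_mul, h.norm_tangent, mul_one, Complex.norm_real, norm_mul, Real.norm_eq_abs,
      Real.norm_eq_abs, abs_of_nonneg (sq_nonneg _)]
    exact mul_le_mul (hC u hu) (hD u hu) (abs_nonneg _) ((sq_nonneg _).trans (hC u hu))
  all_goals exact Continuous.intervalIntegrable (by fun_prop) _ _

lemma hasDerivAt_ofReal (h : IsFrenet v γ τ k) (n : ℕ) (u : ℝ) :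
    HasDerivAt (fun u => (k n u : ℂ)) (v u * k (n + 1) u) u := by
  simpa using (h.curvature_deriv n u).ofReal_comp

/-- Integrate by parts twice; each derivative that falls on `τ` yields a factor `i k`. -/
lemma integral_second_deriv_mul_tangent (h : IsFrenet v γ τ k) :
    ∫ u in (0 : ℝ)..1, v u • (k 2 u * τ u) =
      -(1 / 2) * ∫ u in (0 : ℝ)..1, v u • (((k 0 u ^ 3 : ℝ) : ℂ) * τ u) := by
  have hτ := h.continuous_tangent
  have hk := h.continuous_curvature
  have hv := h.continuous_speed
  have h0 := integral_weighted_deriv_eq_zero hv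
    (f := fun u => (k 1 u : ℂ) * τ u - Complex.I / 2 * ((k 0 u : ℂ) ^ 2 * τ u))
    (f' := fun u => k 2 u * τ u + 1 / 2 * (((k 0 u ^ 3 : ℝ) : ℂ) * τ u)) (fun u => by
      refine (((h.hasDerivAt_ofReal 1 u).mul (h.tangent_deriv u)).sub
        ((((h.hasDerivAt_ofReal 0 u).pow 2).mul (h.tangent_deriv u)).const_mul _)).congr_deriv ?_
      simp only [Complex.real_smul, Pi.pow_apply]
      push_cast
      linear_combination (-(v u * k 0 u ^ 3 * τ u / 2 : ℂ)) * Complex.I_sq)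
    (by fun_prop) (by rw [h.curvature_closed 0, h.curvature_closed 1, h.tangent_closed])
  simp only [smul_add, ← mul_smul_comm] at h0
  rw [intervalIntegral.integral_add, intervalIntegral.integral_const_mul] at h0
  · simp only [← mul_smul_comm]
    linear_combination h0
  all_goals exact Continuous.intervalIntegrable (by fun_prop) _ _

/-- Integration by parts trades the high derivatives for moments that are small: one is quadratic in
`k_s`, the other is a pure power of `k`, to which `norm_moment_le` applies. -/
lemma integral_tangent_mul_third (h : IsFrenet v γ τ k) :
    ∫ u in (0 : ℝ)..1, v u • (τ u * (k 3 u - Complex.I * k 0 u * k 2 u)) =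
      2 * Complex.I * (∫ u in (0 : ℝ)..1, v u • (((k 1 u ^ 2 : ℝ) : ℂ) * τ u)) +
      2 / 3 * Complex.I * ∫ u in (0 : ℝ)..1, v u • (((k 0 u ^ 4 : ℝ) : ℂ) * τ u) := by
  have hτ := h.continuous_tangent
  have hk := h.continuous_curvature
  have hv := h.continuous_speed
  have h0 := integral_weighted_deriv_eq_zero hv
    (f := fun u => (k 2 u : ℂ) * τ u - 2 * Complex.I * ((k 0 u : ℂ) * k 1 u * τ u)
      - 2 / 3 * ((k 0 u : ℂ) ^ 3 * τ u))
    (f' := fun u => τ u * (k 3 u - Complex.I * k 0 u * k 2 u)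
      - 2 * Complex.I * (((k 1 u ^ 2 : ℝ) : ℂ) * τ u)
      - 2 / 3 * Complex.I * (((k 0 u ^ 4 : ℝ) : ℂ) * τ u)) (fun u => by
      refine ((((h.hasDerivAt_ofReal 2 u).mul (h.tangent_deriv u)).sub
        ((((h.hasDerivAt_ofReal 0 u).mul (h.hasDerivAt_ofReal 1 u)).mul
          (h.tangent_deriv u)).const_mul _)).sub
        ((((h.hasDerivAt_ofReal 0 u).pow 3).mul (h.tangent_deriv u)).const_mul _)).congr_deriv ?_
      simp only [Complex.real_smul, Pi.pow_apply, Pi.mul_apply]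
      push_cast
      linear_combination (-(2 * v u * k 0 u ^ 2 * k 1 u * τ u : ℂ)) * Complex.I_sq)
    (by fun_prop) (by
      rw [h.curvature_closed 0, h.curvature_closed 1, h.curvature_closed 2, h.tangent_closed])
  simp only [smul_sub, ← mul_smul_comm] at h0
  rw [intervalIntegral.integral_sub, intervalIntegral.integral_sub,
    intervalIntegral.integral_const_mul, intervalIntegral.integral_const_mul] at h0
  · simp only [smul_sub, ← mul_smul_comm]
    linear_combination h0
  all_goals exact Continuous.intervalIntegrable (by fun_prop) _ _

lemma continuous_frenetOp (h : IsFrenet v γ τ k) : Continuous (frenetOp k) := by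
  have hk := h.continuous_curvature
  unfold frenetOp
  fun_prop

/-- Conjugating the frame flips the sign of the rotation, so the derivative of `τ̄ k_ss` is `τ̄`
times the same bracket `k_sss - i k k_ss` that `τ` multiplies in the next order. -/
lemma conj_tangent_deriv (h : IsFrenet v γ τ k) (u : ℝ) :
    HasDerivAt (fun u => (starRingEnd ℂ) (τ u))
      (v u • (-Complex.I * k 0 u * (starRingEnd ℂ) (τ u))) u := by
  refine (h.tangent_deriv u).star.congr_deriv ?_
  simp

/-- If the variation of the curvature is small, the second derivative of the curvature is controlled
by the Euler–Lagrange operator. -/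
theorem abs_second_deriv_le (h : IsFrenet v γ τ k) {A δ c : ℝ} (hA : 0 ≤ A)
    (hsmall : δ * (3 + 2 * A + 4 * A ^ 2) ≤ 1 / 2)
    (hQ : (∫ u in (0 : ℝ)..1, v u) * ∫ u in (0 : ℝ)..1, v u * |k 1 u| ≤ δ)
    (hkA : ∀ u ∈ Set.Icc (0 : ℝ) 1, (∫ u in (0 : ℝ)..1, v u) * |k 0 u| ≤ A)
    (hcA : (∫ u in (0 : ℝ)..1, v u) * |c| ≤ A)
    (hkc : ∀ u ∈ Set.Icc (0 : ℝ) 1, |k 0 u - c| ≤ ∫ u in (0 : ℝ)..1, v u * |k 1 u|) :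
    ∃ P, 0 ≤ P ∧ (∀ u ∈ Set.Icc (0 : ℝ) 1, |k 2 u| ≤ P) ∧
      (∀ u ∈ Set.Icc (0 : ℝ) 1, |k 1 u| ≤ (∫ u in (0 : ℝ)..1, v u) * P) ∧
      P ≤ 2 * (∫ u in (0 : ℝ)..1, v u) * ∫ u in (0 : ℝ)..1, v u * |frenetOp k u| := by
  have hτ := h.continuous_tangent
  have hk := h.continuous_curvature
  have hv := h.continuous_speed
  have hv0 := h.speed_pos
  have hK := h.continuous_frenetOp
  have hL := integral_weighted_pos hv hv0
  -- `P` is an attained maximum, so the final estimate is needed at the single point `a`.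
  obtain ⟨a, ha, hP⟩ := isCompact_Icc.exists_isMaxOn (s := Set.Icc (0 : ℝ) 1)
    ⟨0, by simp⟩ (hk 2).abs.continuousOn
  obtain ⟨P, hPa⟩ : ∃ P, P = |k 2 a| := ⟨_, rfl⟩
  have hP : ∀ u ∈ Set.Icc (0 : ℝ) 1, |k 2 u| ≤ P := fun u hu => by rw [hPa]; exact hP hu
  have hP0 : 0 ≤ P := by rw [hPa]; positivity
  obtain ⟨L, hLe⟩ : ∃ L, L = ∫ u in (0 : ℝ)..1, v u := ⟨_, rfl⟩
  obtain ⟨Q, hQe⟩ : ∃ Q, Q = ∫ u in (0 : ℝ)..1, v u * |k 1 u| := ⟨_, rfl⟩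
  obtain ⟨X, hXe⟩ : ∃ X, X = ∫ u in (0 : ℝ)..1, v u * |frenetOp k u| := ⟨_, rfl⟩
  rw [← hLe, ← hQe] at hQ
  rw [← hLe] at hcA hL
  simp only [← hLe] at hkA
  simp only [← hQe] at hkc
  rw [← hLe, ← hXe]
  have hQ0 : 0 ≤ Q := hQe ▸ integral_nonneg zero_le_one fun u _ =>
    mul_nonneg (hv0 u).le (abs_nonneg _)
  -- the first derivative
  have hD : ∀ u ∈ Set.Icc (0 : ℝ) 1, |k 1 u| ≤ L * P := fun u hu => by
    have h1 := norm_smul_sub_integral_weighted_le hv hv0 (h.curvature_deriv 1) (hk 2) hu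
    have h2 : ∫ u in (0 : ℝ)..1, v u * ‖k 2 u‖ ≤ L * P := by
      rw [hLe]; exact integral_weighted_le hv hv0 (hk 2).norm hP
    simp only [smul_eq_mul, h.integral_curvature_deriv 0, sub_zero, ← hLe] at h1
    rw [norm_mul, Real.norm_of_nonneg hL.le] at h1
    exact le_of_mul_le_mul_left (h1.trans (mul_le_mul_of_nonneg_left h2 hL.le)) hL
  refine ⟨P, hP0, hP, hD, ?_⟩
  have hQP : Q ≤ L * (L * P) := by
    rw [hQe]; nth_rw 1 [hLe]; exact integral_weighted_le hv hv0 (hk 1).abs hD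
  -- One factor is bounded by `Q`, which supplies the small `δ`, the other by `L² P`, which makes
  -- the bound linear in `P` and hence absorbable.
  have hφ : ∀ u ∈ Set.Icc (0 : ℝ) 1, (k 0 u - c) ^ 2 ≤ δ * (L * P) := fun u hu => by
    calc (k 0 u - c) ^ 2 = |k 0 u - c| * |k 0 u - c| := by rw [← sq, sq_abs]
      _ ≤ Q * (L * (L * P)) := mul_le_mul (hkc u hu) ((hkc u hu).trans hQP) (abs_nonneg _) hQ0
      _ = (L * Q) * (L * P) := by ring
      _ ≤ δ * (L * P) := by gcongr
  have hkA' : ∀ u ∈ Set.Icc (0 : ℝ) 1, |k 0 u| ≤ A / L := fun u hu => by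
    rw [le_div_iff₀ hL, mul_comm]; exact hkA u hu
  have hcA' : |c| ≤ A / L := by
    rw [le_div_iff₀ hL, mul_comm]; exact hcA
  have hAL : 0 ≤ A / L := by positivity
  -- moments of the tangent
  have hJ3 : ‖∫ u in (0 : ℝ)..1, v u • (((k 0 u ^ 3 : ℝ) : ℂ) * τ u)‖ ≤ 3 * A * δ * L * P := by
    -- Taylor expansion at `c`: the tangent line is `3c² x - 2c³`, and `x³` minus it is `(x - c)² (x
    -- + 2c)`.
    have h1 := h.norm_moment_le (fun x => x ^ 3) (fun x => x + 2 * c) (by fun_prop)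
      (3 * c ^ 2) (-2 * c ^ 3) c (fun x => by ring) (D := 3 * (A / L)) hφ (fun u hu => by
        have h1 := abs_le.1 (hkA' u hu)
        have h2 := abs_le.1 hcA'
        rw [abs_le]; constructor <;> linarith [h1.1, h1.2, h2.1, h2.2])
    refine h1.trans_eq ?_
    rw [← hLe]; field_simp
  have hJ4 : ‖∫ u in (0 : ℝ)..1, v u • (((k 0 u ^ 4 : ℝ) : ℂ) * τ u)‖ ≤ 6 * A ^ 2 * δ * P := by
    have h1 := h.norm_moment_le (fun x => x ^ 4) (fun x => x ^ 2 + 2 * c * x + 3 * c ^ 2)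
      (by fun_prop)
      (4 * c ^ 3) (-3 * c ^ 4) c (fun x => by ring) (D := 6 * (A / L) ^ 2) hφ (fun u hu => by
        have h1 := sq_le_sq' (abs_le.1 (hkA' u hu)).1 (abs_le.1 (hkA' u hu)).2
        have h2 := sq_le_sq' (abs_le.1 hcA').1 (abs_le.1 hcA').2
        rw [abs_le]
        constructor <;> nlinarith [sq_nonneg (c - k 0 u), sq_nonneg (c + k 0 u)])
    refine h1.trans_eq ?_
    rw [← hLe]; field_simp
  have hI1 : ∫ u in (0 : ℝ)..1, v u * k 1 u ^ 2 ≤ L * P * Q := by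
    have e : L * P * Q = ∫ u in (0 : ℝ)..1, v u * (L * P * |k 1 u|) := by
      rw [hQe, ← intervalIntegral.integral_const_mul]
      congr 1 with u; ring
    rw [e]
    refine integral_weighted_mono hv hv0 (by fun_prop) (by fun_prop) fun u hu => ?_
    rw [← sq_abs, sq]
    exact mul_le_mul_of_nonneg_right (hD u hu) (abs_nonneg _)
  have hM2 : ‖∫ u in (0 : ℝ)..1, v u • (((k 1 u ^ 2 : ℝ) : ℂ) * τ u)‖ ≤ δ * P := by
    refine (norm_integral_weighted_le hv0 _).trans ?_
    have e : ∀ u, v u * ‖((k 1 u ^ 2 : ℝ) : ℂ) * τ u‖ = v u * k 1 u ^ 2 := fun u => by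
      rw [norm_mul, h.norm_tangent, Complex.norm_real, mul_one,
        Real.norm_of_nonneg (sq_nonneg _)]
    simp_rw [e]
    calc _ ≤ L * P * Q := hI1
      _ = (L * Q) * P := by ring
      _ ≤ _ := by gcongr
  -- the third derivative
  set G := L * X + δ * P * (3 + A / 2 + 4 * A ^ 2) with hG
  have hg : ∀ u ∈ Set.Icc (0 : ℝ) 1, L * ‖(k 3 u - Complex.I * k 0 u * k 2 u : ℂ)‖ ≤ G := by
    intro u hu
    -- Multiplying by `τ` cancels the `k k_sss` terms, leaving `𝒦` plus errors quadratic in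
    -- derivatives of `k`.
    have h1 := norm_smul_sub_integral_weighted_le hv hv0
      (f := fun u => τ u * (k 3 u - Complex.I * k 0 u * k 2 u))
      (f' := fun u => τ u * (frenetOp k u + 1 / 2 * k 1 u ^ 2 * k 0 u
        - Complex.I * k 1 u * k 2 u)) (fun u => by
        refine ((h.tangent_deriv u).mul ((h.hasDerivAt_ofReal 3 u).sub
          (((h.hasDerivAt_ofReal 0 u).const_mul _).mul (h.hasDerivAt_ofReal 2 u)))).congr_deriv ?_
        simp only [Complex.real_smul, frenetOp, Pi.sub_apply, Pi.mul_apply]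
        push_cast
        linear_combination (-(v u * k 0 u ^ 2 * k 2 u * τ u : ℂ)) * Complex.I_sq)
      (by fun_prop) hu
    have h2 : ∫ u in (0 : ℝ)..1, v u * ‖τ u * (frenetOp k u + 1 / 2 * k 1 u ^ 2 * k 0 u
        - Complex.I * k 1 u * k 2 u)‖ ≤ X + 1 / 2 * (A / L) * (L * P * Q) + P * Q := by
      calc _ ≤ ∫ u in (0 : ℝ)..1, v u * (|frenetOp k u| + 1 / 2 * (A / L) * k 1 u ^ 2
              + P * |k 1 u|) := by
            refine integral_weighted_mono hv hv0 (by fun_prop) (by fun_prop) fun u hu => ?_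
            rw [norm_mul, h.norm_tangent, one_mul]
            refine (norm_sub_le _ _).trans (add_le_add ((norm_add_le _ _).trans
              (add_le_add ?_ ?_)) ?_)
            · rw [Complex.norm_real, Real.norm_eq_abs]
            · simp only [norm_mul, norm_pow, Complex.norm_real, Real.norm_eq_abs, sq_abs]
              norm_num
              nlinarith [mul_le_mul_of_nonneg_left (hkA' u hu) (sq_nonneg (k 1 u))]
            · simp only [norm_mul, Complex.norm_I, Complex.norm_real, Real.norm_eq_abs, one_mul]
              rw [mul_comm]
              exact mul_le_mul_of_nonneg_right (hP u hu) (abs_nonneg _)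
        _ = X + 1 / 2 * (A / L) * (∫ u in (0 : ℝ)..1, v u * k 1 u ^ 2) + P * Q := by
            simp_rw [mul_add, mul_left_comm (v _)]
            rw [intervalIntegral.integral_add, intervalIntegral.integral_add,
              intervalIntegral.integral_const_mul, intervalIntegral.integral_const_mul, hXe, hQe]
            all_goals exact Continuous.intervalIntegrable (by fun_prop) _ _
        _ ≤ _ := by gcongr
    have h3 : ‖∫ u in (0 : ℝ)..1, v u • (τ u * (k 3 u - Complex.I * k 0 u * k 2 u))‖ ≤
        2 * (δ * P) + 2 / 3 * (6 * A ^ 2 * δ * P) := by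
      rw [h.integral_tangent_mul_third]
      refine (norm_add_le _ _).trans (add_le_add ?_ ?_)
      · simpa using hM2
      · simpa using hJ4
    rw [← hLe] at h1
    have h4 := norm_le_norm_sub_add (L • (τ u * (k 3 u - Complex.I * k 0 u * k 2 u)))
      (∫ u in (0 : ℝ)..1, v u • (τ u * (k 3 u - Complex.I * k 0 u * k 2 u)))
    rw [norm_smul, norm_mul, h.norm_tangent, one_mul, Real.norm_of_nonneg hL.le] at h4
    refine h4.trans ((add_le_add (h1.trans (mul_le_mul_of_nonneg_left h2 hL.le)) h3).trans ?_)
    have e : L * (X + 1 / 2 * (A / L) * (L * P * Q) + P * Q) =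
        L * X + (L * Q) * (A / 2 * P) + (L * Q) * P := by field_simp
    have e1 : (L * Q) * (A / 2 * P) ≤ δ * (A / 2 * P) := by gcongr
    have e2 : (L * Q) * P ≤ δ * P := by gcongr
    rw [e, hG]
    linarith
  -- the second derivative
  have h1 := norm_smul_sub_integral_weighted_le hv hv0
    (f := fun u => (starRingEnd ℂ) (τ u) * k 2 u)
    (f' := fun u => (starRingEnd ℂ) (τ u) * (k 3 u - Complex.I * k 0 u * k 2 u)) (fun u => by
      refine ((h.conj_tangent_deriv u).mul (h.hasDerivAt_ofReal 2 u)).congr_deriv ?_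
      simp only [Complex.real_smul]
      ring)
    (by fun_prop) ha
  have h2 : ∫ u in (0 : ℝ)..1, v u * ‖(starRingEnd ℂ) (τ u) *
      (k 3 u - Complex.I * k 0 u * k 2 u)‖ ≤ L * (G / L) := by
    nth_rw 1 [hLe]
    refine integral_weighted_le hv hv0 (by fun_prop) fun u hu => ?_
    rw [norm_mul, Complex.norm_conj, h.norm_tangent, one_mul, le_div_iff₀ hL, mul_comm]
    exact hg u hu
  rw [← hLe] at h1
  have h3 : ‖∫ u in (0 : ℝ)..1, v u • ((starRingEnd ℂ) (τ u) * k 2 u)‖ ≤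
      1 / 2 * (3 * A * δ * L * P) := by
    rw [norm_integral_conj_mul, h.integral_second_deriv_mul_tangent]
    simpa using hJ3
  have h4 := norm_le_norm_sub_add (L • ((starRingEnd ℂ) (τ a) * k 2 a))
    (∫ u in (0 : ℝ)..1, v u • ((starRingEnd ℂ) (τ u) * k 2 u))
  rw [norm_smul, norm_mul, Complex.norm_conj, h.norm_tangent, one_mul, Real.norm_of_nonneg hL.le,
    Complex.norm_real, Real.norm_eq_abs, ← hPa] at h4
  have h5 := h4.trans (add_le_add (h1.trans (mul_le_mul_of_nonneg_left h2 hL.le)) h3)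
  rw [mul_div_cancel₀ _ hL.ne'] at h5
  have h6 : L * P ≤ L * (G + 3 / 2 * A * δ * P) := by linarith
  have h7 := le_of_mul_le_mul_left h6 hL
  rw [hG] at h7
  -- The errors add up to `δ P (3 + 2A + 4A²) ≤ P / 2`: the part `3 + A/2 + 4A²` comes from `G`, and
  -- `3A/2` from the mean of `τ̄ k_ss`. Absorbing them gives the factor 2.
  nlinarith [mul_le_mul_of_nonneg_right hsmall hP0]

end IsFrenet

open Set
open scoped ContDiff

/-! ### The Frenet equations of a smooth closed immersed curve -/

lemma _root_.Function.Periodic.deriv' {F : Type} [NormedAddCommGroup F] [NormedSpace ℝ F]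
    {f : ℝ → F} {c : ℝ} (hf : Function.Periodic f c) : Function.Periodic (deriv f) c := fun u => by
  rw [← deriv_comp_add_const, funext hf]

namespace IsSmoothImmersedClosedCurve

variable {F : Type} [NormedAddCommGroup F] [NormedSpace ℝ F] {γ : ℝ → ℂ}

lemma speed_pos (h : IsSmoothImmersedClosedCurve γ) (u : ℝ) : 0 < speed γ u :=
  norm_pos_iff.2 (h.immersed u)

lemma contDiff_speed (h : IsSmoothImmersedClosedCurve γ) : ContDiff ℝ ∞ (speed γ) :=
  (ContDiff.iterate_deriv 1 h.smooth).norm ℝ h.immersed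

lemma contDiff_arcDeriv (h : IsSmoothImmersedClosedCurve γ) {f : ℝ → F} (hf : ContDiff ℝ ∞ f) :
    ContDiff ℝ ∞ (arcDeriv γ f) :=
  (h.contDiff_speed.inv fun u => (h.speed_pos u).ne').smul (ContDiff.iterate_deriv 1 hf)

lemma periodic_arcDeriv (h : IsSmoothImmersedClosedCurve γ) {f : ℝ → F}
    (hf : Function.Periodic f 1) : Function.Periodic (arcDeriv γ f) 1 := fun u => by
  simp only [arcDeriv, speed, h.periodic.deriv' u, hf.deriv' u]

lemma hasDerivAt_arcDeriv (h : IsSmoothImmersedClosedCurve γ) {f : ℝ → F} {u : ℝ}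
    (hf : DifferentiableAt ℝ f u) : HasDerivAt f (speed γ u • arcDeriv γ f u) u := by
  rw [arcDeriv, smul_inv_smul₀ (h.speed_pos u).ne']
  exact hf.hasDerivAt

lemma contDiff_tangent (h : IsSmoothImmersedClosedCurve γ) : ContDiff ℝ ∞ (tangent γ) :=
  h.contDiff_arcDeriv h.smooth

lemma periodic_tangent (h : IsSmoothImmersedClosedCurve γ) : Function.Periodic (tangent γ) 1 :=
  h.periodic_arcDeriv h.periodic

lemma contDiff_curvatureDeriv (h : IsSmoothImmersedClosedCurve γ) (n : ℕ) :
    ContDiff ℝ ∞ (curvatureDeriv γ n) := by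
  induction n with
  | zero =>
    exact ContDiff.inner ℝ (f := arcDeriv γ (tangent γ)) (g := normal γ)
      (h.contDiff_arcDeriv h.contDiff_tangent) (contDiff_const.mul h.contDiff_tangent)
  | succ n ih =>
    rw [curvatureDeriv, Function.iterate_succ_apply']
    exact h.contDiff_arcDeriv ih

lemma periodic_curvatureDeriv (h : IsSmoothImmersedClosedCurve γ) (n : ℕ) :
    Function.Periodic (curvatureDeriv γ n) 1 := by
  induction n with
  | zero =>
    intro u
    simp only [curvatureDeriv, Function.iterate_zero, id, curvature, normal,
      h.periodic_arcDeriv h.periodic_tangent u, h.periodic_tangent u]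
  | succ n ih =>
    rw [curvatureDeriv, Function.iterate_succ_apply']
    exact h.periodic_arcDeriv ih

lemma norm_tangent (h : IsSmoothImmersedClosedCurve γ) (u : ℝ) : ‖tangent γ u‖ = 1 := by
  rw [tangent, arcDeriv, norm_smul, norm_inv, Real.norm_of_nonneg (h.speed_pos u).le]
  exact inv_mul_cancel₀ (h.speed_pos u).ne'

lemma eq_I_mul_of_inner_eq_zero {z w : ℂ} (hz : ‖z‖ = 1) (hw : inner ℝ z w = 0) :
    w = Complex.I * (inner ℝ w (Complex.I * z) : ℝ) * z := by
  have h1 : z.re * z.re + z.im * z.im = 1 := by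
    rw [← Complex.normSq_apply, Complex.normSq_eq_norm_sq, hz, one_pow]
  simp only [Complex.inner, Complex.mul_re, Complex.conj_re, Complex.conj_im] at hw ⊢
  apply Complex.ext
  · simp
    linear_combination (-w.re) * h1 + z.re * hw
  · simp
    linear_combination (-w.im) * h1 + z.im * hw

/-- Differentiating `|τ|² = 1` makes `τ_s` orthogonal to `τ`, hence in the plane a real multiple of
`i τ`. -/
lemma arcDeriv_tangent (h : IsSmoothImmersedClosedCurve γ) (u : ℝ) :
    arcDeriv γ (tangent γ) u = Complex.I * curvatureDeriv γ 0 u * tangent γ u := by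
  refine eq_I_mul_of_inner_eq_zero (h.norm_tangent u) ?_
  have hd : HasDerivAt (tangent γ) (deriv (tangent γ) u) u :=
    (h.contDiff_tangent.differentiable (by simp) u).hasDerivAt
  have h1 := hd.norm_sq
  have e : (fun u => ‖tangent γ u‖ ^ 2) = fun _ => 1 := funext fun u => by
    rw [h.norm_tangent, one_pow]
  rw [e] at h1
  have h2 := h1.unique (hasDerivAt_const u 1)
  rw [arcDeriv, real_inner_smul_right]
  have : inner ℝ (tangent γ u) (deriv (tangent γ) u) = 0 := by linarith
  rw [this, mul_zero]

lemma isFrenet (h : IsSmoothImmersedClosedCurve γ) :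
    IsFrenet (speed γ) γ (tangent γ) (curvatureDeriv γ) where
  continuous_speed := h.contDiff_speed.continuous
  speed_pos := h.speed_pos
  curve_deriv u := h.hasDerivAt_arcDeriv (h.smooth.differentiable (by simp) u)
  tangent_deriv u := by
    rw [← h.arcDeriv_tangent]
    exact h.hasDerivAt_arcDeriv (h.contDiff_tangent.differentiable (by simp) u)
  curvature_deriv n u := by
    rw [show curvatureDeriv γ (n + 1) = arcDeriv γ (curvatureDeriv γ n) from
      Function.iterate_succ_apply' _ _ _]
    exact h.hasDerivAt_arcDeriv ((h.contDiff_curvatureDeriv n).differentiable (by simp) u)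
  norm_tangent := h.norm_tangent
  curve_closed := by simpa using h.periodic 0
  tangent_closed := by simpa using h.periodic_tangent 0
  curvature_closed n := by simpa using h.periodic_curvatureDeriv n 0

end IsSmoothImmersedClosedCurve

/-! ### Functions of time and space that are smooth up to the initial time -/

section Joint

variable {F : Type} [NormedAddCommGroup F] [NormedSpace ℝ F]

/-- Joint smoothness on `[0, ∞) × ℝ`. -/
def SmoothFromZero (f : ℝ → ℝ → F) : Prop :=
  ContDiffOn ℝ ∞ (fun p : ℝ × ℝ => f p.1 p.2) (Ici 0 ×ˢ univ)

lemma uniqueDiffOn_Ici_prod_univ : UniqueDiffOn ℝ (Ici (0 : ℝ) ×ˢ (univ : Set ℝ)) :=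
  (uniqueDiffOn_Ici 0).prod uniqueDiffOn_univ

lemma hasDerivAt_fst_slice {G : ℝ × ℝ → F} {G' : ℝ × ℝ →L[ℝ] F} {t u : ℝ}
    (hG : HasFDerivAt G G' (t, u)) : HasDerivAt (fun r => G (r, u)) (G' (1, 0)) t :=
  HasFDerivAt.comp_hasDerivAt (f := fun r : ℝ => (r, u)) t hG
    ((hasDerivAt_id' t).prodMk (hasDerivAt_const t u))

lemma hasDerivAt_snd_slice {G : ℝ × ℝ → F} {G' : ℝ × ℝ →L[ℝ] F} {t u : ℝ}
    (hG : HasFDerivAt G G' (t, u)) : HasDerivAt (fun x => G (t, x)) (G' (0, 1)) u :=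
  HasFDerivAt.comp_hasDerivAt (f := fun x : ℝ => (t, x)) u hG
    ((hasDerivAt_const u t).prodMk (hasDerivAt_id' u))

lemma _root_.HasDerivAt.clm_apply_const {E : Type} [NormedAddCommGroup E] [NormedSpace ℝ E]
    {c : ℝ → E →L[ℝ] F} {c' : E →L[ℝ] F} {t : ℝ} (hc : HasDerivAt c c' t) (e : E) :
    HasDerivAt (fun r => c r e) (c' e) t := by
  simpa using hc.clm_apply (hasDerivAt_const t e)

namespace SmoothFromZero

variable {f g : ℝ → ℝ → F}

/-- A time slice lies wholly in the half-plane, even at `t = 0`, so the derivative within the domain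
restricts to a genuine space derivative. -/
lemma hasDerivAt_slice (hf : SmoothFromZero f) {t : ℝ} (ht : 0 ≤ t) (u : ℝ) :
    HasDerivAt (f t) (fderivWithin ℝ (fun p : ℝ × ℝ => f p.1 p.2) (Ici 0 ×ˢ univ) (t, u) (0, 1))
      u := by
  have h1 := ((hf.differentiableOn (by simp)) (t, u) ⟨ht, mem_univ _⟩).hasFDerivWithinAt
  have h2 : HasDerivWithinAt (fun x : ℝ => (t, x)) (0, 1) univ u :=
    ((hasDerivAt_const u t).prodMk (hasDerivAt_id u)).hasDerivWithinAt
  have h3 := h1.comp_hasDerivWithinAt u h2 (fun x _ => ⟨ht, mem_univ _⟩)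
  rwa [hasDerivWithinAt_univ] at h3

lemma deriv_slice (hf : SmoothFromZero f) : SmoothFromZero fun t u => deriv (f t) u := by
  have h1 : ContDiffOn ℝ ∞ (fderivWithin ℝ (fun p : ℝ × ℝ => f p.1 p.2) (Ici 0 ×ˢ univ))
    (Ici 0 ×ˢ univ) := ContDiffOn.fderivWithin hf uniqueDiffOn_Ici_prod_univ (by simp)
  refine (h1.clm_apply (contDiffOn_const (c := ((0 : ℝ), (1 : ℝ))))).congr fun p hp => ?_
  exact (hf.hasDerivAt_slice hp.1 p.2).deriv

lemma contDiffAt (hf : SmoothFromZero f) {t : ℝ} (ht : 0 < t) (u : ℝ) :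
    ContDiffAt ℝ ∞ (fun p : ℝ × ℝ => f p.1 p.2) (t, u) :=
  ContDiffOn.contDiffAt hf (prod_mem_nhds (Ici_mem_nhds ht) Filter.univ_mem)

lemma contDiff_slice (hf : SmoothFromZero f) {t : ℝ} (ht : 0 ≤ t) : ContDiff ℝ ∞ (f t) := by
  rw [← contDiffOn_univ]
  exact ContDiffOn.comp (t := Ici (0 : ℝ) ×ˢ (univ : Set ℝ)) hf
    (contDiff_prodMk_right t).contDiffOn (fun x _ => ⟨ht, mem_univ _⟩)

/-- The time derivative commutes with the space derivative. -/
lemma hasDerivAt_deriv_slice (hf : SmoothFromZero f)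
    (hg : ∀ t, 0 < t → ∀ u, HasDerivAt (fun r => f r u) (g t u) t) {t : ℝ} (ht : 0 < t) (u : ℝ) :
    HasDerivAt (fun r => deriv (f r) u) (deriv (g t) u) t := by
  set G : ℝ × ℝ → F := fun p => f p.1 p.2
  have hG := hf.contDiffAt ht u
  have hG1 : ∀ {r : ℝ}, 0 < r → ∀ x, HasFDerivAt G (fderiv ℝ G (r, x)) (r, x) := fun hr x =>
    ((hf.contDiffAt hr x).differentiableAt (by simp)).hasFDerivAt
  have e1 : ∀ {r : ℝ}, 0 < r → ∀ x, deriv (f r) x = fderiv ℝ G (r, x) (0, 1) := fun {r} hr x =>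
    (hasDerivAt_snd_slice (hG1 hr x)).deriv
  have e2 : ∀ {r : ℝ}, 0 < r → ∀ x, g r x = fderiv ℝ G (r, x) (1, 0) := fun {r} hr x =>
    (hg r hr x).unique (hasDerivAt_fst_slice (hG1 hr x))
  have h2 : HasFDerivAt (fderiv ℝ G) (fderiv ℝ (fderiv ℝ G) (t, u)) (t, u) := by
    have : ContDiffAt ℝ 1 (fderiv ℝ G) (t, u) := hG.fderiv_right (by norm_cast)
    exact (this.differentiableAt (by simp)).hasFDerivAt
  -- The commutation is the symmetry of the second derivative at an interior point.
  have hs : IsSymmSndFDerivAt ℝ G (t, u) := hG.isSymmSndFDerivAt (by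
    rw [minSmoothness_of_isRCLikeNormedField]; norm_cast)
  have h3 := (hasDerivAt_fst_slice h2).clm_apply_const (0, 1)
  have h4 := (hasDerivAt_snd_slice h2).clm_apply_const (1, 0)
  have e3 : deriv (g t) u = fderiv ℝ (fderiv ℝ G) (t, u) (0, 1) (1, 0) := by
    rw [funext (e2 ht)]; exact h4.deriv
  rw [e3, hs (0, 1) (1, 0)]
  refine h3.congr_of_eventuallyEq ?_
  filter_upwards [Ioi_mem_nhds ht] with r hr using e1 hr u

lemma continuousOn_integral (hf : SmoothFromZero f) :
    ContinuousOn (fun t => ∫ u in (0 : ℝ)..1, f t u) (Ici 0) := by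
  -- Freezing `f` at its initial value for negative times gives a function continuous on the whole
  -- plane.
  have h1 : Continuous fun p : ℝ × ℝ => f (max p.1 0) p.2 :=
    ContinuousOn.comp_continuous (s := Ici (0 : ℝ) ×ˢ (univ : Set ℝ))
      (f := fun p : ℝ × ℝ => (max p.1 0, p.2)) hf.continuousOn (by fun_prop)
      fun p => ⟨le_max_right p.1 0, mem_univ _⟩
  have h2 : Continuous fun t : ℝ => ∫ u in (0 : ℝ)..1, f (max t 0) u :=
    continuous_parametric_intervalIntegral_of_continuous' (f := fun t u => f (max t 0) u) h1 0 1
  refine h2.continuousOn.congr fun t ht => ?_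
  simp only [max_eq_left (mem_Ici.1 ht)]

/-- Differentiation under the integral sign. -/
lemma hasDerivAt_integral (hf : SmoothFromZero f) (hg' : SmoothFromZero g)
    (hg : ∀ t, 0 < t → ∀ u, HasDerivAt (fun r => f r u) (g t u) t) {t : ℝ} (ht : 0 < t) :
    HasDerivAt (fun r => ∫ u in (0 : ℝ)..1, f r u) (∫ u in (0 : ℝ)..1, g t u) t := by
  have hc : IsCompact (Icc (t / 2) (2 * t) ×ˢ Icc (0 : ℝ) 1) := isCompact_Icc.prod isCompact_Icc
  have hsub : Icc (t / 2) (2 * t) ×ˢ Icc (0 : ℝ) 1 ⊆ Ici (0 : ℝ) ×ˢ (univ : Set ℝ) :=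
    fun p hp => ⟨(by positivity : (0 : ℝ) ≤ t / 2).trans hp.1.1, mem_univ _⟩
  obtain ⟨C, hC⟩ := hc.exists_bound_of_continuousOn (hg'.continuousOn.mono hsub)
  have hpos : ∀ x ∈ Icc (t / 2) (2 * t), 0 < x := fun x hx =>
    (by positivity : (0 : ℝ) < t / 2).trans_le hx.1
  refine (intervalIntegral.hasDerivAt_integral_of_dominated_loc_of_deriv_le (μ := MeasureTheory.volume)
    (bound := fun _ => C) (s := Icc (t / 2) (2 * t))
    (Icc_mem_nhds (half_lt_self ht) (by linarith)) ?_ ?_ ?_ ?_ ?_ ?_).2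
  · filter_upwards [Ioi_mem_nhds ht] with x hx
    exact (hf.contDiff_slice (mem_Ioi.1 hx).le).continuous.aestronglyMeasurable
  · exact (hf.contDiff_slice ht.le).continuous.intervalIntegrable _ _
  · exact (hg'.contDiff_slice ht.le).continuous.aestronglyMeasurable
  · refine Filter.Eventually.of_forall fun u hu x hx => ?_
    rw [uIoc_of_le zero_le_one] at hu
    exact hC (x, u) ⟨hx, hu.1.le, hu.2⟩
  · exact continuous_const.intervalIntegrable _ _
  · exact Filter.Eventually.of_forall fun u _ x hx => hg x (hpos x hx) u

end SmoothFromZero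

end Joint

/-- The `n`-th arclength derivative of the Euler–Lagrange operator. -/
def idealOpDeriv (γ : ℝ → ℂ) (n : ℕ) : ℝ → ℝ := (arcDeriv γ)^[n] (idealOp γ)

namespace IsSmoothImmersedClosedCurve

variable {γ : ℝ → ℂ}

lemma contDiff_idealOpDeriv (h : IsSmoothImmersedClosedCurve γ) (n : ℕ) :
    ContDiff ℝ ∞ (idealOpDeriv γ n) := by
  induction n with
  | zero =>
    have h4 := h.contDiff_curvatureDeriv 4
    have h2 := h.contDiff_curvatureDeriv 2
    have h1 := h.contDiff_curvatureDeriv 1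
    have h0 : ContDiff ℝ ∞ (curvature γ) := h.contDiff_curvatureDeriv 0
    change ContDiff ℝ ∞ (fun u => curvatureDeriv γ 4 u + curvatureDeriv γ 2 u * curvature γ u ^ 2
      - 1 / 2 * curvatureDeriv γ 1 u ^ 2 * curvature γ u)
    fun_prop
  | succ n ih =>
    rw [idealOpDeriv, Function.iterate_succ_apply']
    exact h.contDiff_arcDeriv ih

lemma hasDerivAt_idealOpDeriv (h : IsSmoothImmersedClosedCurve γ) (n : ℕ) (u : ℝ) :
    HasDerivAt (idealOpDeriv γ n) (speed γ u * idealOpDeriv γ (n + 1) u) u := by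
  rw [show idealOpDeriv γ (n + 1) = arcDeriv γ (idealOpDeriv γ n) from
    Function.iterate_succ_apply' _ _ _]
  exact h.hasDerivAt_arcDeriv ((h.contDiff_idealOpDeriv n).differentiable (by simp) u)

lemma idealOpDeriv_closed (h : IsSmoothImmersedClosedCurve γ) (n : ℕ) :
    idealOpDeriv γ n 1 = idealOpDeriv γ n 0 := by
  suffices hp : Function.Periodic (idealOpDeriv γ n) 1 by simpa using hp 0
  induction n with
  | zero =>
    intro u
    have h0 : Function.Periodic (curvature γ) 1 := h.periodic_curvatureDeriv 0
    change idealOp γ (u + 1) = idealOp γ u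
    simp only [idealOp, h.periodic_curvatureDeriv 4 u, h.periodic_curvatureDeriv 2 u,
      h.periodic_curvatureDeriv 1 u, h0 u]
  | succ n ih =>
    rw [idealOpDeriv, Function.iterate_succ_apply']
    exact h.periodic_arcDeriv ih

lemma hasDerivAt_tangent (h : IsSmoothImmersedClosedCurve γ) (u : ℝ) :
    HasDerivAt (tangent γ) (speed γ u * (Complex.I * curvature γ u * tangent γ u)) u :=
  (h.isFrenet.tangent_deriv u).congr_deriv (by rw [Complex.real_smul]; rfl)

lemma deriv_eq (h : IsSmoothImmersedClosedCurve γ) (u : ℝ) :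
    deriv γ u = speed γ u * tangent γ u := by
  simpa using (h.isFrenet.curve_deriv u).deriv

/-- The space derivative of the normal velocity. -/
lemma hasDerivAt_velocity (h : IsSmoothImmersedClosedCurve γ) (u : ℝ) :
    HasDerivAt (fun u => idealOp γ u • normal γ u)
      (speed γ u * (idealOpDeriv γ 1 u * Complex.I - idealOp γ u * curvature γ u) * tangent γ u)
      u := by
  have h1 := (h.hasDerivAt_idealOpDeriv 0 u).smul ((h.hasDerivAt_tangent u).const_mul Complex.I)
  refine h1.congr_deriv ?_
  simp only [Complex.real_smul, idealOpDeriv, Function.iterate_zero, id]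
  push_cast
  linear_combination
    (idealOp γ u * speed γ u * curvature γ u * tangent γ u : ℂ) * Complex.I_sq

end IsSmoothImmersedClosedCurve

/-! ### Evolution equations -/

namespace IsIdealCurveFlow

variable {F : Type} [NormedAddCommGroup F] [NormedSpace ℝ F]
variable {γ₀ : ℝ → ℂ} {γ : ℝ → ℝ → ℂ}

lemma smooth_curve (h : IsIdealCurveFlow γ₀ γ) : SmoothFromZero γ := h.smooth

lemma smooth_speed (h : IsIdealCurveFlow γ₀ γ) : SmoothFromZero fun t u => speed (γ t) u :=
  ContDiffOn.norm ℝ h.smooth_curve.deriv_slice fun p hp => (h.curve p.1 hp.1).immersed p.2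

lemma smooth_arcDeriv (h : IsIdealCurveFlow γ₀ γ) {f : ℝ → ℝ → F} (hf : SmoothFromZero f) :
    SmoothFromZero fun t u => arcDeriv (γ t) (f t) u :=
  (ContDiffOn.inv h.smooth_speed fun p hp => ((h.curve p.1 hp.1).speed_pos p.2).ne').smul
    hf.deriv_slice

lemma smooth_tangent (h : IsIdealCurveFlow γ₀ γ) : SmoothFromZero fun t u => tangent (γ t) u :=
  h.smooth_arcDeriv h.smooth_curve

lemma smooth_curvatureDeriv (h : IsIdealCurveFlow γ₀ γ) (n : ℕ) :
    SmoothFromZero fun t u => curvatureDeriv (γ t) n u := by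
  induction n with
  | zero =>
    exact ContDiffOn.inner ℝ (h.smooth_arcDeriv h.smooth_tangent)
      (contDiffOn_const.mul h.smooth_tangent)
  | succ n ih =>
    simp only [curvatureDeriv, Function.iterate_succ_apply']
    exact h.smooth_arcDeriv ih

lemma smooth_curvature (h : IsIdealCurveFlow γ₀ γ) :
    SmoothFromZero fun t u => curvature (γ t) u := h.smooth_curvatureDeriv 0

lemma smooth_idealOpDeriv (h : IsIdealCurveFlow γ₀ γ) (n : ℕ) :
    SmoothFromZero fun t u => idealOpDeriv (γ t) n u := by
  induction n with
  | zero =>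
    have h4 := h.smooth_curvatureDeriv 4
    have h2 := h.smooth_curvatureDeriv 2
    have h1 := h.smooth_curvatureDeriv 1
    have h0 := h.smooth_curvature
    change SmoothFromZero (fun t u => curvatureDeriv (γ t) 4 u +
      curvatureDeriv (γ t) 2 u * curvature (γ t) u ^ 2
      - 1 / 2 * curvatureDeriv (γ t) 1 u ^ 2 * curvature (γ t) u)
    unfold SmoothFromZero at *
    fun_prop
  | succ n ih =>
    simp only [idealOpDeriv, Function.iterate_succ_apply']
    exact h.smooth_arcDeriv ih

lemma smooth_idealOp (h : IsIdealCurveFlow γ₀ γ) :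
    SmoothFromZero fun t u => idealOp (γ t) u := h.smooth_idealOpDeriv 0

lemma hasDerivAt_curve (h : IsIdealCurveFlow γ₀ γ) {t : ℝ} (ht : 0 < t) (u : ℝ) :
    HasDerivAt (fun r => γ r u) (idealOp (γ t) u • normal (γ t) u) t :=
  (h.evolution t ht.le u).hasDerivAt (Ici_mem_nhds ht)

lemma hasDerivAt_deriv_curve (h : IsIdealCurveFlow γ₀ γ) {t : ℝ} (ht : 0 < t) (u : ℝ) :
    HasDerivAt (fun r => deriv (γ r) u)
      (speed (γ t) u * (idealOpDeriv (γ t) 1 u * Complex.I - idealOp (γ t) u * curvature (γ t) u)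
        * tangent (γ t) u) t := by
  have h1 := h.smooth_curve.hasDerivAt_deriv_slice (fun t ht u => h.hasDerivAt_curve ht u) ht u
  rwa [((h.curve t ht.le).hasDerivAt_velocity u).deriv] at h1

lemma _root_.IdealCurve.SmoothFromZero.differentiableAt_time {f : ℝ → ℝ → F}
    (hf : SmoothFromZero f) {t : ℝ} (ht : 0 < t) (u : ℝ) :
    DifferentiableAt ℝ (fun r => f r u) t :=
  (hasDerivAt_fst_slice
    ((hf.contDiffAt ht u).differentiableAt (by simp)).hasFDerivAt).differentiableAt

/-- Differentiability comes from joint smoothness; the value is read off from the derivative of the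
squared speed, after division by `2 v`. -/
lemma hasDerivAt_speed (h : IsIdealCurveFlow γ₀ γ) {t : ℝ} (ht : 0 < t) (u : ℝ) :
    HasDerivAt (fun r => speed (γ r) u)
      (-(speed (γ t) u * curvature (γ t) u * idealOp (γ t) u)) t := by
  have hc := h.curve t ht.le
  have h1 := (h.smooth_speed.differentiableAt_time ht u).hasDerivAt
  have h2 : HasDerivAt (fun r => speed (γ r) u ^ 2) _ t := (h.hasDerivAt_deriv_curve ht u).norm_sq
  have h3 := (h1.pow 2).unique h2
  refine h1.congr_deriv ?_
  have h4 := hc.norm_tangent u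
  have h5 : (tangent (γ t) u).re ^ 2 + (tangent (γ t) u).im ^ 2 = 1 := by
    rw [sq, sq, ← Complex.normSq_apply, Complex.normSq_eq_norm_sq, h4, one_pow]
  have h6 : inner ℝ (deriv (γ t) u) (speed (γ t) u * (idealOpDeriv (γ t) 1 u * Complex.I -
      idealOp (γ t) u * curvature (γ t) u) * tangent (γ t) u) =
      speed (γ t) u * -(speed (γ t) u * curvature (γ t) u * idealOp (γ t) u) := by
    rw [hc.deriv_eq, Complex.inner]
    simp
    linear_combination
      (-(speed (γ t) u ^ 2 * curvature (γ t) u * idealOp (γ t) u)) * h5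
  rw [h6] at h3
  have h7 := hc.speed_pos u
  refine mul_left_cancel₀ h7.ne' ?_
  simp at h3
  linarith

/-- The tangential part of `∂ₜ∂ᵤγ` cancels against the derivative of `v⁻¹`, leaving the rotation of
`τ` at rate `𝒦_s`. -/
lemma hasDerivAt_tangent (h : IsIdealCurveFlow γ₀ γ) {t : ℝ} (ht : 0 < t) (u : ℝ) :
    HasDerivAt (fun r => tangent (γ r) u)
      (idealOpDeriv (γ t) 1 u * Complex.I * tangent (γ t) u) t := by
  have hc := h.curve t ht.le
  have hv := (hc.speed_pos u).ne'
  have hv' : (speed (γ t) u : ℂ) ≠ 0 := by exact_mod_cast hv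
  have h1 := ((h.hasDerivAt_speed ht u).inv hv).smul (h.hasDerivAt_deriv_curve ht u)
  refine h1.congr_deriv ?_
  simp only [hc.deriv_eq, Complex.real_smul, Pi.inv_apply]
  push_cast
  field_simp
  ring

/-- Compute `∂ₜ∂ᵤτ` twice: from `∂ᵤτ = v i k τ`, and by exchanging derivatives from `∂ₜτ = i 𝒦_s τ`.
Comparing and cancelling `v i τ` isolates `∂ₜk`. -/
lemma hasDerivAt_curvature (h : IsIdealCurveFlow γ₀ γ) {t : ℝ} (ht : 0 < t) (u : ℝ) :
    HasDerivAt (fun r => curvature (γ r) u)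
      (idealOpDeriv (γ t) 2 u + curvature (γ t) u ^ 2 * idealOp (γ t) u) t := by
  have hc := h.curve t ht.le
  have hv' : (speed (γ t) u : ℂ) ≠ 0 := by exact_mod_cast (hc.speed_pos u).ne'
  have hτ : tangent (γ t) u ≠ 0 := norm_ne_zero_iff.1 (by rw [hc.norm_tangent]; exact one_ne_zero)
  have h1 := (h.smooth_curvature.differentiableAt_time ht u).hasDerivAt
  have h2 := h.smooth_tangent.hasDerivAt_deriv_slice (fun t ht u => h.hasDerivAt_tangent ht u) ht u
  have h3 := (((hc.hasDerivAt_idealOpDeriv 1 u).ofReal_comp.mul_const Complex.I).mul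
    (hc.hasDerivAt_tangent u)).deriv
  have h4 : HasDerivAt (fun r => deriv (tangent (γ r)) u) _ t :=
    ((h.hasDerivAt_speed ht u).ofReal_comp.mul
      ((h1.ofReal_comp.const_mul Complex.I).mul (h.hasDerivAt_tangent ht u))).congr_of_eventuallyEq
    (by
      filter_upwards [Ioi_mem_nhds ht] with r hr
      exact ((h.curve r (mem_Ioi.1 hr).le).hasDerivAt_tangent u).deriv)
  have h5 := h4.unique h2
  refine h1.congr_deriv ?_
  have h6 := h5.trans h3
  simp only [Pi.mul_apply] at h6
  push_cast at h6
  have h7 : (speed (γ t) u * Complex.I * tangent (γ t) u) *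
      ((deriv (fun r => curvature (γ r) u) t : ℝ) : ℂ) =
      (speed (γ t) u * Complex.I * tangent (γ t) u) *
      ((idealOpDeriv (γ t) 2 u + curvature (γ t) u ^ 2 * idealOp (γ t) u : ℝ) : ℂ) := by
    push_cast
    linear_combination h6
  exact_mod_cast mul_left_cancel₀ (mul_ne_zero (mul_ne_zero hv' Complex.I_ne_zero) hτ) h7

/-- Differentiating `k² 𝒦` in `s` gives `2 k k_s 𝒦`; the time derivative of `v⁻¹` contributes one
more `k k_s 𝒦`, whence the 3. -/
lemma hasDerivAt_curvatureDeriv_one (h : IsIdealCurveFlow γ₀ γ) {t : ℝ} (ht : 0 < t) (u : ℝ) :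
    HasDerivAt (fun r => curvatureDeriv (γ r) 1 u)
      (idealOpDeriv (γ t) 3 u + 3 * curvature (γ t) u * curvatureDeriv (γ t) 1 u * idealOp (γ t) u
        + curvature (γ t) u ^ 2 * idealOpDeriv (γ t) 1 u) t := by
  have hc := h.curve t ht.le
  have hv := (hc.speed_pos u).ne'
  have hk : HasDerivAt (curvature (γ t)) _ u := hc.isFrenet.curvature_deriv 0 u
  have hK : HasDerivAt (idealOp (γ t)) _ u := hc.hasDerivAt_idealOpDeriv 0 u
  have h1 := h.smooth_curvature.hasDerivAt_deriv_slice
    (fun t ht u => h.hasDerivAt_curvature ht u) ht u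
  have h2 := ((hc.hasDerivAt_idealOpDeriv 2 u).add ((hk.pow 2).mul hK)).deriv
  have h3 := ((h.hasDerivAt_speed ht u).inv hv).smul h1
  refine h3.congr_deriv ?_
  have h4 : deriv (fun u => idealOpDeriv (γ t) 2 u + curvature (γ t) u ^ 2 * idealOp (γ t) u) u =
    _ := h2
  rw [h4, hk.deriv]
  simp only [smul_eq_mul, Pi.inv_apply, Pi.pow_apply]
  push_cast
  field_simp
  ring

end IsIdealCurveFlow

lemma arcIntegral_eq (γ : ℝ → ℂ) (f : ℝ → ℝ) :
    arcIntegral γ f = ∫ u in (0 : ℝ)..1, speed γ u * f u := by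
  simp only [arcIntegral, mul_comm]

lemma length_eq (γ : ℝ → ℂ) : length γ = ∫ u in (0 : ℝ)..1, speed γ u := by
  simp [length, arcIntegral_eq]

/-! ### Integral identities -/

namespace IsSmoothImmersedClosedCurve

variable {γ : ℝ → ℂ}

lemma length_pos (h : IsSmoothImmersedClosedCurve γ) : 0 < length γ := by
  rw [length_eq]
  exact integral_weighted_pos h.contDiff_speed.continuous h.speed_pos

lemma arcIntegral_nonneg (h : IsSmoothImmersedClosedCurve γ) {f : ℝ → ℝ} (hf : ∀ u, 0 ≤ f u) :
    0 ≤ arcIntegral γ f :=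
  integral_nonneg zero_le_one fun u _ => mul_nonneg (hf u) (h.speed_pos u).le

lemma energy_nonneg (h : IsSmoothImmersedClosedCurve γ) : 0 ≤ energy γ :=
  mul_nonneg (by norm_num) (h.arcIntegral_nonneg fun _ => sq_nonneg _)

lemma idealOpNormSq_nonneg (h : IsSmoothImmersedClosedCurve γ) : 0 ≤ idealOpNormSq γ :=
  h.arcIntegral_nonneg fun _ => sq_nonneg _

lemma arcIntegral_idealOpDeriv (h : IsSmoothImmersedClosedCurve γ) (n : ℕ) :
    arcIntegral γ (idealOpDeriv γ (n + 1)) = 0 := by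
  rw [arcIntegral_eq]
  exact integral_weighted_deriv_eq_zero h.contDiff_speed.continuous
    (f := idealOpDeriv γ n) (f' := idealOpDeriv γ (n + 1)) (h.hasDerivAt_idealOpDeriv n)
    (h.contDiff_idealOpDeriv _).continuous (h.idealOpDeriv_closed n)

lemma arcIntegral_curvature_mul_idealOp (h : IsSmoothImmersedClosedCurve γ) :
    arcIntegral γ (fun u => curvature γ u * idealOp γ u) =
      arcIntegral γ (fun u => curvatureDeriv γ 2 u ^ 2) -
        7 / 2 * arcIntegral γ (fun u => curvature γ u ^ 2 * curvatureDeriv γ 1 u ^ 2) := by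
  have hF := h.isFrenet
  have hv := hF.continuous_speed
  have hk := hF.continuous_curvature
  have hk0 : Continuous (curvature γ) := hk 0
  have hK : Continuous (idealOp γ) := (h.contDiff_idealOpDeriv 0).continuous
  have d0 : ∀ u, HasDerivAt (curvature γ) (speed γ u * curvatureDeriv γ 1 u) u :=
    hF.curvature_deriv 0
  have d := hF.curvature_deriv
  have e0 : curvature γ 1 = curvature γ 0 := hF.curvature_closed 0
  have h0 := integral_weighted_deriv_eq_zero hv
    (f := fun u => curvature γ u * curvatureDeriv γ 3 u
      - curvatureDeriv γ 1 u * curvatureDeriv γ 2 u + curvature γ u ^ 3 * curvatureDeriv γ 1 u)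
    (f' := fun u => curvature γ u * idealOp γ u - curvatureDeriv γ 2 u ^ 2
      + 7 / 2 * (curvature γ u ^ 2 * curvatureDeriv γ 1 u ^ 2)) (fun u => by
      refine ((((d0 u).mul (d 3 u)).sub ((d 1 u).mul (d 2 u))).add
        (((d0 u).pow 3).mul (d 1 u))).congr_deriv ?_
      simp only [smul_eq_mul, idealOp, Pi.pow_apply]
      push_cast
      ring) (by fun_prop)
    (by rw [e0, hF.curvature_closed 1, hF.curvature_closed 2, hF.curvature_closed 3])
  simp only [smul_eq_mul, mul_add, mul_sub, mul_left_comm (speed γ _) (7 / 2)] at h0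
  rw [intervalIntegral.integral_add, intervalIntegral.integral_sub,
    intervalIntegral.integral_const_mul] at h0
  · simp only [arcIntegral_eq]
    linarith
  all_goals exact Continuous.intervalIntegrable (by fun_prop) _ _

/-- The first variation of the energy in the direction of the Euler–Lagrange operator. -/
lemma integral_first_variation (h : IsSmoothImmersedClosedCurve γ) :
    ∫ u in (0 : ℝ)..1, speed γ u * (2 * curvatureDeriv γ 1 u *
      (idealOpDeriv γ 3 u + 3 * curvature γ u * curvatureDeriv γ 1 u * idealOp γ u
        + curvature γ u ^ 2 * idealOpDeriv γ 1 u)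
      - curvatureDeriv γ 1 u ^ 2 * (curvature γ u * idealOp γ u)) = -2 * idealOpNormSq γ := by
  have hF := h.isFrenet
  have hv := hF.continuous_speed
  have hk := hF.continuous_curvature
  have hk0 : Continuous (curvature γ) := hk 0
  have hKn := fun n => (h.contDiff_idealOpDeriv n).continuous
  have hK : Continuous (idealOp γ) := hKn 0
  have d0 : ∀ u, HasDerivAt (curvature γ) (speed γ u * curvatureDeriv γ 1 u) u :=
    hF.curvature_deriv 0
  have d := hF.curvature_deriv
  have D0 : ∀ u, HasDerivAt (idealOp γ) (speed γ u * idealOpDeriv γ 1 u) u :=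
    h.hasDerivAt_idealOpDeriv 0
  have D := h.hasDerivAt_idealOpDeriv
  have e0 : curvature γ 1 = curvature γ 0 := hF.curvature_closed 0
  have E0 : idealOp γ 1 = idealOp γ 0 := h.idealOpDeriv_closed 0
  -- Integration by parts moves all derivatives off `𝒦`. The variation of `ds` contributes `-k_s² k
  -- 𝒦`, which is what turns the factor of `𝒦` into `-2𝒦`.
  have h0 := integral_weighted_deriv_eq_zero hv
    (f := fun u => 2 * (curvatureDeriv γ 1 u * idealOpDeriv γ 2 u
      + curvatureDeriv γ 1 u * (curvature γ u ^ 2 * idealOp γ u)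
      - curvatureDeriv γ 2 u * idealOpDeriv γ 1 u + curvatureDeriv γ 3 u * idealOp γ u))
    (f' := fun u => (2 * curvatureDeriv γ 1 u *
      (idealOpDeriv γ 3 u + 3 * curvature γ u * curvatureDeriv γ 1 u * idealOp γ u
        + curvature γ u ^ 2 * idealOpDeriv γ 1 u)
      - curvatureDeriv γ 1 u ^ 2 * (curvature γ u * idealOp γ u)) + 2 * idealOp γ u ^ 2)
    (fun u => by
      refine (((((d 1 u).mul (D 2 u)).add ((d 1 u).mul (((d0 u).pow 2).mul (D0 u)))).sub
        ((d 2 u).mul (D 1 u))).add ((d 3 u).mul (D0 u)) |>.const_mul 2).congr_deriv ?_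
      simp only [smul_eq_mul, Pi.pow_apply, Pi.mul_apply]
      rw [idealOp]
      push_cast
      ring) (by fun_prop)
    (by rw [e0, E0, hF.curvature_closed 1, hF.curvature_closed 2, hF.curvature_closed 3,
      h.idealOpDeriv_closed 1, h.idealOpDeriv_closed 2])
  simp only [smul_eq_mul] at h0
  simp_rw [mul_add (speed γ _) _ (2 * idealOp γ _ ^ 2), mul_left_comm (speed γ _) 2] at h0
  rw [intervalIntegral.integral_add, intervalIntegral.integral_const_mul] at h0
  · simp only [idealOpNormSq, arcIntegral_eq]
    linarith
  all_goals exact Continuous.intervalIntegrable (by fun_prop) _ _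

/-! ### The estimate for curves of small energy -/

/-- Cauchy–Schwarz gives `(∫ |k_s|)² ≤ 2 L E`; this is how small scaled energy makes `δ` small. -/
lemma sq_length_mul_arcIntegral_abs_le (h : IsSmoothImmersedClosedCurve γ) :
    (length γ * ∫ u in (0 : ℝ)..1, speed γ u * |curvatureDeriv γ 1 u|) ^ 2 ≤
      2 * scaledEnergy γ := by
  have h1 := sq_integral_weighted_le h.contDiff_speed.continuous h.speed_pos
    (h.contDiff_curvatureDeriv 1).continuous.abs
  simp only [sq_abs] at h1
  rw [← length_eq] at h1
  rw [mul_pow, scaledEnergy, energy, arcIntegral_eq]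
  nlinarith [mul_le_mul_of_nonneg_left h1 (sq_nonneg (length γ))]

/-- For a curve of winding number `w` and small scaled energy, the Euler–Lagrange operator controls
the energy and the growth of the length. -/
theorem energy_and_length_estimate (h : IsSmoothImmersedClosedCurve γ) {w ε A : ℝ}
    (hw : windingNumber γ = w) (hA : A = 2 * Real.pi * |w| + 1)
    (hε1 : 8 * ε * (3 + 2 * A + 4 * A ^ 2) ^ 2 ≤ 1) (hε2 : 84 * A ^ 2 * ε ≤ 1)
    (hE : scaledEnergy γ ≤ ε) :
    3 * length γ ^ 2 * energy γ * -arcIntegral γ (fun u => curvature γ u * idealOp γ u) ≤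
      1 / 2 * (length γ ^ 3 * idealOpNormSq γ) := by
  have hv := h.contDiff_speed.continuous
  have hv0 := h.speed_pos
  have hF := h.isFrenet
  have hk := hF.continuous_curvature
  have hk0 : Continuous (curvature γ) := hk 0
  have hL := h.length_pos
  have hA1 : 1 ≤ A := by rw [hA]; have := Real.pi_pos; nlinarith [mul_nonneg this.le (abs_nonneg w)]
  have hE0 : 0 ≤ scaledEnergy γ := mul_nonneg (by positivity) h.energy_nonneg
  set Q := ∫ u in (0 : ℝ)..1, speed γ u * |curvatureDeriv γ 1 u| with hQ
  set δ := length γ * Q with hδ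
  have hQ0 : 0 ≤ Q := integral_nonneg zero_le_one fun u _ => mul_nonneg (hv0 u).le (abs_nonneg _)
  have hδ2 : δ ^ 2 ≤ 2 * ε := h.sq_length_mul_arcIntegral_abs_le.trans (by linarith)
  have hB : 3 ≤ 3 + 2 * A + 4 * A ^ 2 := by nlinarith
  have hsmall : δ * (3 + 2 * A + 4 * A ^ 2) ≤ 1 / 2 := by
    refine abs_le_of_sq_le_sq' ?_ (by norm_num) |>.2
    rw [mul_pow]
    nlinarith [mul_le_mul_of_nonneg_right hδ2 (sq_nonneg (3 + 2 * A + 4 * A ^ 2))]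
  have hδ1 : δ ≤ 1 := by nlinarith
  have hmean : (∫ u in (0 : ℝ)..1, speed γ u • curvatureDeriv γ 0 u) = 2 * Real.pi * w := by
    rw [← hw, windingNumber, arcIntegral_eq]
    simp only [smul_eq_mul]
    field_simp
    rfl
  -- The mean curvature, determined by the winding number and the length.
  set c := 2 * Real.pi * w / length γ with hc
  have hLc : length γ * c = 2 * Real.pi * w := by rw [hc]; field_simp
  have habs : |2 * Real.pi * w| = 2 * Real.pi * |w| := by
    rw [abs_mul, abs_of_pos Real.two_pi_pos]
  have hkc : ∀ u ∈ Icc (0 : ℝ) 1, |curvatureDeriv γ 0 u - c| ≤ Q := fun u hu => by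
    have h1 := norm_smul_sub_integral_weighted_le hv hv0 (hF.curvature_deriv 0) (hk 1) hu
    rw [hmean, ← length_eq, smul_eq_mul, ← hLc, ← mul_sub, norm_mul,
      Real.norm_of_nonneg hL.le] at h1
    exact le_of_mul_le_mul_left h1 hL
  have hLc' : length γ * |c| = 2 * Real.pi * |w| := by
    rw [← habs, ← hLc, abs_mul, abs_of_pos hL]
  have hcA : length γ * |c| ≤ A := by rw [hLc', hA]; linarith
  -- The `+ 1` in `A` accounts for the oscillation, as `L |k - c| ≤ δ ≤ 1`.
  have hkA : ∀ u ∈ Icc (0 : ℝ) 1, length γ * |curvatureDeriv γ 0 u| ≤ A := fun u hu => by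
    have h1 : |curvatureDeriv γ 0 u| ≤ |curvatureDeriv γ 0 u - c| + |c| := by
      simpa using abs_add_le (curvatureDeriv γ 0 u - c) c
    have h3 := mul_le_mul_of_nonneg_left (h1.trans (add_le_add_left (hkc u hu) _)) hL.le
    rw [mul_add, hLc'] at h3
    rw [hA]
    linarith
  obtain ⟨P, hP0, -, hD, hPX⟩ := hF.abs_second_deriv_le (A := A) (δ := δ) (c := c)
    (by linarith) hsmall (by rw [← length_eq]) (by rwa [← length_eq]) (by rwa [← length_eq]) hkc
  rw [← length_eq] at hD hPX
  set N := idealOpNormSq γ with hN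
  have hN0 : 0 ≤ N := h.idealOpNormSq_nonneg
  have hX : (∫ u in (0 : ℝ)..1, speed γ u * |frenetOp (curvatureDeriv γ) u|) ^ 2 ≤
      length γ * N := by
    have h1 := sq_integral_weighted_le hv hv0 hF.continuous_frenetOp.abs
    simp only [sq_abs] at h1
    rw [← length_eq] at h1
    rwa [hN, idealOpNormSq, arcIntegral_eq]
  have hP2 : P ^ 2 ≤ 4 * length γ ^ 3 * N := by
    calc P ^ 2 ≤ (2 * length γ *
          ∫ u in (0 : ℝ)..1, speed γ u * |frenetOp (curvatureDeriv γ) u|) ^ 2 :=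
          pow_le_pow_left₀ hP0 hPX 2
      _ = 4 * length γ ^ 2 *
          (∫ u in (0 : ℝ)..1, speed γ u * |frenetOp (curvatureDeriv γ) u|) ^ 2 := by ring
      _ ≤ 4 * length γ ^ 2 * (length γ * N) := by gcongr
      _ = _ := by ring
  have hkk : arcIntegral γ (fun u => curvature γ u ^ 2 * curvatureDeriv γ 1 u ^ 2) ≤
      length γ * (A ^ 2 * P ^ 2) := by
    rw [arcIntegral_eq, length_eq]
    refine integral_weighted_le hv hv0 (by fun_prop) fun u hu => ?_
    rw [← sq_abs (curvature γ u), ← sq_abs (curvatureDeriv γ 1 u), ← mul_pow, ← mul_pow]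
    refine pow_le_pow_left₀ (by positivity) ?_ 2
    calc |curvature γ u| * |curvatureDeriv γ 1 u| ≤ |curvature γ u| * (length γ * P) := by
          gcongr; exact hD u hu
      _ = (length γ * |curvature γ u|) * P := by ring
      _ ≤ A * P := mul_le_mul_of_nonneg_right (hkA u hu) hP0
  -- The term `-∫ k_ss²` has a favourable sign and is discarded.
  have hLt : -arcIntegral γ (fun u => curvature γ u * idealOp γ u) ≤
      7 / 2 * (length γ * (A ^ 2 * (4 * length γ ^ 3 * N))) := by
    rw [h.arcIntegral_curvature_mul_idealOp]
    have h1 : 0 ≤ arcIntegral γ (fun u => curvatureDeriv γ 2 u ^ 2) :=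
      h.arcIntegral_nonneg fun _ => sq_nonneg _
    have h2 : length γ * (A ^ 2 * P ^ 2) ≤ length γ * (A ^ 2 * (4 * length γ ^ 3 * N)) := by
      gcongr
    linarith
  have hen := h.energy_nonneg
  calc _ ≤ 3 * length γ ^ 2 * energy γ * (7 / 2 * (length γ * (A ^ 2 * (4 * length γ ^ 3 * N)))) :=
        mul_le_mul_of_nonneg_left hLt (by positivity)
    _ = (42 * A ^ 2 * scaledEnergy γ) * (length γ ^ 3 * N) := by rw [scaledEnergy]; ring
    _ ≤ 1 / 2 * (length γ ^ 3 * N) := by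
        refine mul_le_mul_of_nonneg_right ?_ (by positivity)
        nlinarith [mul_le_mul_of_nonneg_left hE (by positivity : 0 ≤ 84 * A ^ 2)]

end IsSmoothImmersedClosedCurve

/-! ### Monotonicity along the flow -/

namespace IsIdealCurveFlow

variable {γ₀ : ℝ → ℂ} {γ : ℝ → ℝ → ℂ}

lemma hasDerivAt_length (h : IsIdealCurveFlow γ₀ γ) {t : ℝ} (ht : 0 < t) :
    HasDerivAt (fun r => length (γ r))
      (-arcIntegral (γ t) (fun u => curvature (γ t) u * idealOp (γ t) u)) t := by
  have hv := h.smooth_speed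
  have hk := h.smooth_curvature
  have hK := h.smooth_idealOp
  have h1 := h.smooth_speed.hasDerivAt_integral
    (g := fun t u => -(speed (γ t) u * curvature (γ t) u * idealOp (γ t) u))
    (by unfold SmoothFromZero at *; fun_prop) (fun t ht u => h.hasDerivAt_speed ht u) ht
  simp only [length_eq, arcIntegral_eq]
  simpa only [intervalIntegral.integral_neg, mul_assoc] using h1

lemma hasDerivAt_energy (h : IsIdealCurveFlow γ₀ γ) {t : ℝ} (ht : 0 < t) :
    HasDerivAt (fun r => energy (γ r)) (-idealOpNormSq (γ t)) t := by
  have hv := h.smooth_speed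
  have hk := h.smooth_curvature
  have hk1 := h.smooth_curvatureDeriv 1
  have hK := h.smooth_idealOp
  have hK1 := h.smooth_idealOpDeriv 1
  have hK3 := h.smooth_idealOpDeriv 3
  have h1 := SmoothFromZero.hasDerivAt_integral
    (f := fun t u => speed (γ t) u * curvatureDeriv (γ t) 1 u ^ 2)
    (g := fun t u => speed (γ t) u * (2 * curvatureDeriv (γ t) 1 u *
      (idealOpDeriv (γ t) 3 u + 3 * curvature (γ t) u * curvatureDeriv (γ t) 1 u * idealOp (γ t) u
        + curvature (γ t) u ^ 2 * idealOpDeriv (γ t) 1 u)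
      - curvatureDeriv (γ t) 1 u ^ 2 * (curvature (γ t) u * idealOp (γ t) u)))
    (by unfold SmoothFromZero at *; fun_prop) (by unfold SmoothFromZero at *; fun_prop)
    (fun t ht u => by
      refine ((h.hasDerivAt_speed ht u).mul
        ((h.hasDerivAt_curvatureDeriv_one ht u).pow 2)).congr_deriv ?_
      simp only [Pi.pow_apply]
      push_cast
      ring) ht
  rw [(h.curve t ht.le).integral_first_variation] at h1
  simp only [energy, arcIntegral_eq]
  exact (h1.const_mul (1 / 2)).congr_deriv (by ring)

/-- The term `k² 𝒦` in `∂ₜk` cancels against the change of `ds`, so the integrand evolves by the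
exact derivative `𝒦_ss ds`. -/
lemma hasDerivAt_total_curvature (h : IsIdealCurveFlow γ₀ γ) {t : ℝ} (ht : 0 < t) :
    HasDerivAt (fun r => arcIntegral (γ r) (curvature (γ r))) 0 t := by
  have hv := h.smooth_speed
  have hk := h.smooth_curvature
  have hK2 := h.smooth_idealOpDeriv 2
  have h1 := SmoothFromZero.hasDerivAt_integral
    (f := fun t u => speed (γ t) u * curvature (γ t) u)
    (g := fun t u => speed (γ t) u * idealOpDeriv (γ t) 2 u)
    (by unfold SmoothFromZero at *; fun_prop) (by unfold SmoothFromZero at *; fun_prop)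
    (fun t ht u => by
      refine ((h.hasDerivAt_speed ht u).mul (h.hasDerivAt_curvature ht u)).congr_deriv ?_
      ring) ht
  rw [← arcIntegral_eq, (h.curve t ht.le).arcIntegral_idealOpDeriv] at h1
  simpa only [arcIntegral_eq] using h1

lemma continuousOn_length (h : IsIdealCurveFlow γ₀ γ) :
    ContinuousOn (fun t => length (γ t)) (Ici 0) := by
  simp only [length_eq]
  exact h.smooth_speed.continuousOn_integral

lemma continuousOn_scaledEnergy (h : IsIdealCurveFlow γ₀ γ) :
    ContinuousOn (fun t => scaledEnergy (γ t)) (Ici 0) := by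
  have hv := h.smooth_speed
  have hk1 := h.smooth_curvatureDeriv 1
  have h1 := SmoothFromZero.continuousOn_integral
    (f := fun t u => speed (γ t) u * curvatureDeriv (γ t) 1 u ^ 2)
    (by unfold SmoothFromZero at *; fun_prop)
  simp only [scaledEnergy, energy, arcIntegral_eq]
  exact (h.continuousOn_length.pow 3).mul (h1.const_mul _)

lemma continuousOn_dissipation (h : IsIdealCurveFlow γ₀ γ) :
    ContinuousOn (fun t => length (γ t) ^ 3 * idealOpNormSq (γ t)) (Ici 0) := by
  have hv := h.smooth_speed
  have hK := h.smooth_idealOp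
  have h1 := SmoothFromZero.continuousOn_integral
    (f := fun t u => speed (γ t) u * idealOp (γ t) u ^ 2)
    (by unfold SmoothFromZero at *; fun_prop)
  simp only [idealOpNormSq, arcIntegral_eq]
  exact (h.continuousOn_length.pow 3).mul h1

/-- The winding number is preserved by the flow. -/
lemma windingNumber_eq (h : IsIdealCurveFlow γ₀ γ) {t : ℝ} (ht : 0 ≤ t) :
    windingNumber (γ t) = windingNumber γ₀ := by
  rcases ht.eq_or_lt with rfl | ht
  · rw [h.initial]
  have hv := h.smooth_speed
  have hk := h.smooth_curvature
  have hc : ContinuousOn (fun t => arcIntegral (γ t) (curvature (γ t))) (Ici 0) := by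
    simp only [arcIntegral_eq]
    exact SmoothFromZero.continuousOn_integral
      (f := fun t u => speed (γ t) u * curvature (γ t) u)
      (by unfold SmoothFromZero at *; fun_prop)
  have h1 := integral_eq_sub_of_hasDeriv_right_of_le ht.le (hc.mono Icc_subset_Ici_self)
    (f' := fun _ => 0) (fun x hx => (h.hasDerivAt_total_curvature hx.1).hasDerivWithinAt)
    intervalIntegrable_const
  rw [intervalIntegral.integral_zero, h.initial] at h1
  rw [windingNumber, windingNumber]
  congr 1
  linarith

lemma hasDerivAt_scaledEnergy (h : IsIdealCurveFlow γ₀ γ) {t : ℝ} (ht : 0 < t) :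
    HasDerivAt (fun r => scaledEnergy (γ r))
      (3 * length (γ t) ^ 2 * energy (γ t) *
        -arcIntegral (γ t) (fun u => curvature (γ t) u * idealOp (γ t) u)
        - length (γ t) ^ 3 * idealOpNormSq (γ t)) t := by
  refine (((h.hasDerivAt_length ht).pow 3).mul (h.hasDerivAt_energy ht)).congr_deriv ?_
  simp only [Pi.pow_apply]
  push_cast
  ring

end IsIdealCurveFlow

/-- A continuous function that is non-increasing as long as it lies below a level stays
non-increasing. -/
lemma antitoneOn_of_deriv_nonpos_of_lt {f f' : ℝ → ℝ} {ε : ℝ} (hf : ContinuousOn f (Ici 0))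
    (hd : ∀ t, 0 < t → HasDerivAt f (f' t) t) (hf' : ∀ t, 0 < t → f t < ε → f' t ≤ 0)
    (h0 : f 0 < ε) : AntitoneOn f (Ici 0) ∧ ∀ t, 0 ≤ t → f t < ε := by
  have key : ∀ T, 0 ≤ T → (∀ t ∈ Ioo 0 T, f t < ε) → AntitoneOn f (Icc 0 T) := fun T hT hlt => by
    refine antitoneOn_of_deriv_nonpos (convex_Icc 0 T) (hf.mono Icc_subset_Ici_self) ?_ ?_
    · rw [interior_Icc]
      exact fun x hx => (hd x hx.1).differentiableAt.differentiableWithinAt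
    · rw [interior_Icc]
      exact fun x hx => (hd x hx.1).deriv ▸ hf' x hx.1 (hlt x hx)
  have hlt : ∀ t, 0 ≤ t → f t < ε := by
    by_contra! hne
    obtain ⟨T, hT, hTε⟩ := hne
    have hclosed : IsCompact (Icc 0 T ∩ f ⁻¹' Ici ε) :=
      isCompact_Icc.of_isClosed_subset
        ((hf.mono Icc_subset_Ici_self).preimage_isClosed_of_isClosed isClosed_Icc isClosed_Ici)
        inter_subset_left
    -- At the first time `s` with `f s ≥ ε`, monotonicity on `[0, s]` forces `f s ≤ f 0 < ε`, a
    -- contradiction.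
    obtain ⟨s, hs, hmin⟩ := hclosed.exists_isLeast ⟨T, ⟨hT, le_rfl⟩, hTε⟩
    have hanti := key s hs.1.1 fun t ht => by
      by_contra! hge
      exact absurd (hmin ⟨⟨ht.1.le, ht.2.le.trans hs.1.2⟩, hge⟩) (not_le.2 ht.2)
    have h1 := hanti ⟨le_rfl, hs.1.1⟩ ⟨hs.1.1, le_rfl⟩ hs.1.1
    exact absurd (h1.trans_lt h0) (not_lt.2 hs.2)
  refine ⟨fun a ha b hb hab => ?_, hlt⟩
  exact key b hb (fun t ht => hlt t ht.1.le) ⟨ha, hab⟩ ⟨hb, le_rfl⟩ hab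

end IdealCurve

end

/-! ### Choice of the constants and conclusion -/

theorem proposition7p3 (ω : ℤ) (ε₀ : ℝ) (hε₀ : 0 < ε₀) :
    ∃ ε₁ ε₂ C₀ : ℝ, 0 < ε₂ ∧ ε₂ ≤ ε₁ ∧ ε₁ < ε₀ ∧ 0 < C₀ ∧
      ∀ (γ₀ : ℝ → ℂ) (γ : ℝ → ℝ → ℂ),
        IdealCurve.IsSmoothImmersedClosedCurve γ₀ →
        IdealCurve.windingNumber γ₀ = (ω : ℝ) →
        IdealCurve.IsIdealCurveFlow γ₀ γ →
        (IdealCurve.scaledEnergy γ₀ < ε₁ →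
          AntitoneOn (fun t => IdealCurve.scaledEnergy (γ t)) (Set.Ici 0)) ∧
        (IdealCurve.scaledEnergy γ₀ < ε₂ →
          ∀ t : ℝ, 0 ≤ t →
            IntervalIntegrable
              (fun r => IdealCurve.length (γ r) ^ 3 * IdealCurve.idealOpNormSq (γ r))
              MeasureTheory.volume 0 t ∧
            ∫ r in (0 : ℝ)..t, IdealCurve.length (γ r) ^ 3 * IdealCurve.idealOpNormSq (γ r)
              ≤ C₀ * (IdealCurve.scaledEnergy γ₀ - IdealCurve.scaledEnergy (γ t))) := by
  set A : ℝ := 2 * Real.pi * |(ω : ℝ)| + 1 with hA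
  have hA0 : 0 < A := by have := Real.pi_pos; positivity
  set B : ℝ := 3 + 2 * A + 4 * A ^ 2 with hB
  have hB0 : 0 < B := by positivity
  -- The three bounds give in turn `ε < ε₀`, the smallness `δ B ≤ ½` (from `δ² ≤ 2ε`), and `42 A² ε
  -- ≤ ½`, which is the share of the dissipation lost to length growth.
  set ε : ℝ := min (ε₀ / 2) (min (1 / (8 * B ^ 2)) (1 / (84 * A ^ 2))) with hε
  have hεpos : 0 < ε := by positivity
  have hε1 : 8 * ε * B ^ 2 ≤ 1 := by
    have : ε ≤ 1 / (8 * B ^ 2) := (min_le_right _ _).trans (min_le_left _ _)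
    rw [le_div_iff₀ (by positivity)] at this
    linarith
  have hε2 : 84 * A ^ 2 * ε ≤ 1 := by
    have : ε ≤ 1 / (84 * A ^ 2) := (min_le_right _ _).trans (min_le_right _ _)
    rw [le_div_iff₀ (by positivity)] at this
    linarith
  -- One threshold serves both parts; `C₀ = 2` since half of the dissipation survives.
  refine ⟨ε, ε, 2, hεpos, le_rfl, (min_le_left _ _).trans_lt (half_lt_self hε₀), two_pos, ?_⟩
  intro γ₀ γ _ hω h
  have hest : ∀ t, 0 < t → IdealCurve.scaledEnergy (γ t) < ε →
      3 * IdealCurve.length (γ t) ^ 2 * IdealCurve.energy (γ t) * -IdealCurve.arcIntegral (γ t)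
        (fun u => IdealCurve.curvature (γ t) u * IdealCurve.idealOp (γ t) u) ≤
        1 / 2 * (IdealCurve.length (γ t) ^ 3 * IdealCurve.idealOpNormSq (γ t)) := fun t ht hlt =>
    (h.curve t ht.le).energy_and_length_estimate ((h.windingNumber_eq ht.le).trans hω) hA hε1 hε2
      hlt.le
  have hN : ∀ t, 0 < t → 0 ≤ IdealCurve.length (γ t) ^ 3 * IdealCurve.idealOpNormSq (γ t) :=
    fun t ht => mul_nonneg (pow_nonneg (h.curve t ht.le).length_pos.le 3)
      (h.curve t ht.le).idealOpNormSq_nonneg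
  have hmono := fun h0 : IdealCurve.scaledEnergy γ₀ < ε =>
    IdealCurve.antitoneOn_of_deriv_nonpos_of_lt (ε := ε) h.continuousOn_scaledEnergy
      (fun t ht => h.hasDerivAt_scaledEnergy ht)
      (fun t ht hlt => by linarith [hest t ht hlt, hN t ht])
      (by rwa [h.initial])
  refine ⟨fun h0 => (hmono h0).1, fun h0 t ht => ?_⟩
  have hcont : ContinuousOn (fun r => IdealCurve.length (γ r) ^ 3 * IdealCurve.idealOpNormSq (γ r))
      (Set.Icc 0 t) := h.continuousOn_dissipation.mono Set.Icc_subset_Ici_self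
  refine ⟨ContinuousOn.intervalIntegrable (by rwa [Set.uIcc_of_le ht]), ?_⟩
  -- Only an upper bound for the derivative on the open interval is needed, together with continuity
  -- up to `t = 0`.
  have h1 := intervalIntegral.sub_le_integral_of_hasDeriv_right_of_le ht
    (h.continuousOn_scaledEnergy.mono Set.Icc_subset_Ici_self)
    (fun x hx => (h.hasDerivAt_scaledEnergy hx.1).hasDerivWithinAt)
    ((hcont.const_mul (-(1 / 2))).integrableOn_Icc)
    (fun x hx => by linarith [hest x hx.1 ((hmono h0).2 x hx.1.le)])
  rw [intervalIntegral.integral_const_mul, h.initial] at h1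
  linarith
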